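/- Let $N,d\ge 1$ be integers and $t\in\mathbb{R}$. For $V:\mathbb{C}\to\mathbb{R}$ and $n\ge1$ put $$\mathcal Z_n[V]=\int_{\mathbb{C}^n}\prod_{j=1}^{n}e^{-nV(\lambda_j)}\prod_{1\le i<j\le n}|\lambda_j-\lambda_i|^2\,d^2\lambda_1\cdots d^2\lambda_n ,$$ and let $\mathcal Z^{(\mathrm{Lem}_d)}_{n}(t)=\mathcal Z_n[V]$ with $V(\lambda)=|\lambda|^{2d}-t(\lambda^d+\overline{\lambda}^{\,d})$ and $\mathcal Z^{(\mathrm{Gin})}_{n}=\mathcal Z_n[V]$ with $V(\lambda)=|\lambda|^2$. Let $G_N=N^{-1/2}G$, where $G$ is an $N\times N$ matrix with i.i.d. standard complex normal entries (density $\pi^{-1}e^{-|z|^2}$ on $\mathbb{C}$). Set $$\gamma_\ell=-2\Big(1-\frac{\ell+1}{d}\Big)\quad(\ell=0,\dots,d-1),\qquad c_{N,d}=(Nd)!\,d^{-N(Nd+2d+1)/2}\,(N!)^{-d}.$$ Then the integrals defining $\mathcal Z^{(\mathrm{Lem}_d)}_{Nd}(t)$ and $\mathcal Z^{(\mathrm{Gin})}_{N}$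 and all the expectations below are finite, and $$\mathcal Z^{(\mathrm{Lem}_d)}_{Nd}(t)=e^{(Ntd)^2}\,c_{N,d}\,\big(\mathcal Z^{(\mathrm{Gin})}_{N}\big)^{d}\prod_{\ell=0}^{d-1}\mathbb E\big(|\det(G_N-t\sqrt d)|^{\gamma_\ell}\big),$$ where $$\mathcal Z^{(\mathrm{Gin})}_{N}=\pi^N\,\frac{\prod_{k=1}^{N}k!}{N^{N(N+1)/2}} .$$ -/

import Mathlib

open MeasureTheory

noncomputable section

namespace Lemniscate

/-- The unnormalised joint density `∏ⱼ exp(-n V(λⱼ)) ∏_{i<j} |λⱼ - λᵢ|²` of the normal matrix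
model with `n` points and external potential `V`. -/
def weight (n : ℕ) (V : ℂ → ℝ) (z : Fin n → ℂ) : ℝ :=
  (∏ j, Real.exp (-(n : ℝ) * V (z j))) * ∏ i, ∏ j ∈ Finset.Ioi i, ‖z j - z i‖ ^ 2

/-- The partition function of the normal matrix model: the integral of `weight n V` over `ℂⁿ`
with respect to Lebesgue measure. -/
def partitionFunction (n : ℕ) (V : ℂ → ℝ) : ℝ :=
  ∫ z : Fin n → ℂ, weight n V z

/-- The potential `|λ|²` of the complex Ginibre ensemble. -/
def ginibrePotential (z : ℂ) : ℝ := ‖z‖ ^ 2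

/-- The lemniscate potential `|λ|^{2d} - t (λ^d + conj(λ)^d)`; the bracket is real, which is why
taking its real part changes nothing. -/
def lemniscatePotential (d : ℕ) (t : ℝ) (z : ℂ) : ℝ :=
  ‖z‖ ^ (2 * d) - t * (z ^ d + (starRingEnd ℂ z) ^ d).re

/-- The law of a standard complex normal variable: density `π⁻¹ exp(-|z|²)` on `ℂ`. -/
def stdComplexNormal : Measure ℂ :=
  volume.withDensity fun z => ENNReal.ofReal (Real.pi⁻¹ * Real.exp (-‖z‖ ^ 2))

/-- The joint law of the i.i.d. standard complex normal entries of an `N × N` matrix `G`. -/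
def gaussianEntries (N : ℕ) : Measure (Fin N × Fin N → ℂ) :=
  Measure.pi fun _ => stdComplexNormal

/-- The matrix `G_N = N^{-1/2} G` with the prescribed entries of `G`. -/
def ginibreMatrix (N : ℕ) (g : Fin N × Fin N → ℂ) : Matrix (Fin N) (Fin N) ℂ :=
  Matrix.of fun i j => g (i, j) / (Real.sqrt N : ℂ)

/-- The random variable `|det (G_N - z)|^γ`. -/
def absDetPow (N : ℕ) (γ : ℝ) (z : ℂ) (g : Fin N × Fin N → ℂ) : ℝ :=
  ‖(ginibreMatrix N g - z • (1 : Matrix (Fin N) (Fin N) ℂ)).det‖ ^ γ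

/-- The expectation `𝔼 |det (G_N - z)|^γ` for a standard complex Ginibre matrix `G_N`. -/
def ginibreMoment (N : ℕ) (γ : ℝ) (z : ℂ) : ℝ :=
  ∫ g, absDetPow N γ z g ∂(gaussianEntries N)

/-- The exponent `γ_ℓ = -2 (1 - (ℓ + 1) / d)`. -/
def gammaExponent (d ℓ : ℕ) : ℝ := -2 * (1 - ((ℓ : ℝ) + 1) / d)

/-- The constant `c_{N,d} = (Nd)! d^{-N(Nd+2d+1)/2} (N!)^{-d}`. -/
def reductionConstant (N d : ℕ) : ℝ :=
  ((N * d).factorial : ℝ) * (d : ℝ) ^ (-((N : ℝ) * (N * d + 2 * d + 1) / 2)) *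
    ((N.factorial : ℝ) ^ d)⁻¹

end Lemniscate

end

/-! Completing the square, `|z|^{2d} - t(z^d + conj z^d) = |z^d - t|² - t²`, makes the lemniscate
weight a function of `z^d`. Andréief's identity writes the partition function as the determinant of
the moments `∫ conj(z)^i z^j w(z) dz`, and invariance of `w` under the `d`-th roots of unity kills
those with `i ≢ j` modulo `d`. The moment matrix is therefore block diagonal with one block per
residue class `ℓ`, and the substitution `u = z^d` turns the block of `ℓ` into the moment matrix of
the planar weight `|u|^{γ_ℓ} exp(-Nd|u - t|²)`. After rescaling, Andréief's identity in reverse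
expresses each block through a Ginibre ensemble with a point charge of strength `γ_ℓ`.

Such a charged integral is a moment of a characteristic polynomial once the eigenvalue law of the
Ginibre matrix is known. That law is obtained by peeling off one eigenvalue `x` with eigenvector
`(1, q)`. With all entries but the corner `a` fixed, the eigenvalues of a matrix of size `n + 1` are
the solutions of `R(x) = a` for a rational function `R` of degree `n + 1`, so by the area formula
the change of variables counts every matrix `n + 1` times, and its Jacobian is the Vandermonde
factor `|det(B - x)|²` of the remaining eigenvalues. Unitary invariance of the Frobenius norm makes
the integral over `q` a constant, which is never computed: it is read off from the case `γ = 0`,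
where the expectation equals `1`. -/

namespace Lemniscate

section AreaFormula

open scoped ENNReal
open Set Polynomial

variable {E : Type*} [NormedAddCommGroup E] [NormedSpace ℝ E] [FiniteDimensional ℝ E]
  [MeasurableSpace E] [BorelSpace E] {μ : Measure E} [μ.IsAddHaarMeasure]

lemma count_inter_fibre_eq_indicator_image {α β : Type*} [MeasurableSpace α]
    [MeasurableSingletonClass α] {f : α → β} {s : Set α} (hf : InjOn f s) (b : β) :
    Measure.count (s ∩ f ⁻¹' {b}) = (f '' s).indicator (1 : β → ℝ≥0∞) b := by
  by_cases hb : b ∈ f '' s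
  · obtain ⟨x, hx, rfl⟩ := hb
    have hfibre : s ∩ f ⁻¹' {f x} = {x} :=
      Subset.antisymm (fun y hy => hf hy.1 hx hy.2) (by rintro y rfl; exact ⟨hx, rfl⟩)
    simp [hfibre, mem_image_of_mem f hx]
  · have hfibre : s ∩ f ⁻¹' {b} = ∅ := eq_empty_of_forall_notMem fun x hx => hb ⟨x, hx⟩
    simp [hfibre, hb]

lemma lintegral_abs_det_fderiv_mul_of_injOn {f : E → E} {f' : E → E →L[ℝ] E} {s : Set E}
    (hs : MeasurableSet s) (hf' : ∀ x ∈ s, HasFDerivWithinAt f (f' x) s x) (hf : InjOn f s)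
    (h : E → ℝ≥0∞) :
    ∫⁻ x in s, ENNReal.ofReal |(f' x).det| * h (f x) ∂μ =
      ∫⁻ a, Measure.count (s ∩ f ⁻¹' {a}) * h a ∂μ := by
  rw [← lintegral_image_eq_lintegral_abs_det_fderiv_mul μ hs hf' hf,
    ← lintegral_indicator (measurable_image_of_fderivWithin hs hf' hf)]
  refine lintegral_congr fun a => ?_
  rw [count_inter_fibre_eq_indicator_image hf, ← indicator_mul_left]
  simp

theorem lintegral_abs_det_fderiv_mul_of_countable_injOn {f : E → E} {f' : E → E →L[ℝ] E}
    {s : Set E} (hs : MeasurableSet s) (hf' : ∀ x ∈ s, HasFDerivWithinAt f (f' x) s x)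
    {V : ℕ → Set E} (hV : ∀ n, MeasurableSet (V n)) (hf : ∀ n, InjOn f (V n))
    (hsV : s ⊆ ⋃ n, V n) {h : E → ℝ≥0∞} (hh : Measurable h) :
    ∫⁻ x in s, ENNReal.ofReal |(f' x).det| * h (f x) ∂μ =
      ∫⁻ a, Measure.count (s ∩ f ⁻¹' {a}) * h a ∂μ := by
  set P : ℕ → Set E := fun n => s ∩ disjointed V n
  have hPm n : MeasurableSet (P n) := hs.inter (.disjointed hV n)
  have hPd : Pairwise (Function.onFun Disjoint P) := fun i j hij =>
    (disjoint_disjointed V hij).mono inter_subset_right inter_subset_right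
  have hPs : ⋃ n, P n = s := by
    rw [← inter_iUnion, iUnion_disjointed, inter_eq_left.2 hsV]
  have hPf n : InjOn f (P n) := (hf n).mono (inter_subset_right.trans (disjointed_subset V n))
  have hPf' n : ∀ x ∈ P n, HasFDerivWithinAt f (f' x) (P n) x :=
    fun x hx => (hf' x hx.1).mono inter_subset_left
  have hfibre a : Measure.count (s ∩ f ⁻¹' {a}) = ∑' n, Measure.count (P n ∩ f ⁻¹' {a}) := by
    rw [← hPs, iUnion_inter, measure_iUnion]
    · exact fun i j hij => (hPd hij).mono inter_subset_left inter_subset_left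
    · exact fun n => Set.Subsingleton.measurableSet fun x hx y hy =>
        hPf n hx.1 hy.1 (hx.2.trans hy.2.symm)
  have hmeas n : Measurable fun a => Measure.count (P n ∩ f ⁻¹' {a}) * h a := by
    simp_rw [count_inter_fibre_eq_indicator_image (hPf n)]
    exact (measurable_one.indicator
      (measurable_image_of_fderivWithin (hPm n) (hPf' n) (hPf n))).mul hh
  calc ∫⁻ x in s, ENNReal.ofReal |(f' x).det| * h (f x) ∂μ
      = ∑' n, ∫⁻ x in P n, ENNReal.ofReal |(f' x).det| * h (f x) ∂μ := by
        rw [← lintegral_iUnion hPm hPd, hPs]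
    _ = ∑' n, ∫⁻ a, Measure.count (P n ∩ f ⁻¹' {a}) * h a ∂μ := by
        simp_rw [lintegral_abs_det_fderiv_mul_of_injOn (hPm _) (hPf' _) (hPf _)]
    _ = ∫⁻ a, Measure.count (s ∩ f ⁻¹' {a}) * h a ∂μ := by
        rw [← lintegral_tsum fun n => (hmeas n).aemeasurable]
        simp_rw [ENNReal.tsum_mul_right, hfibre]

lemma exists_isOpen_injOn_of_hasStrictDerivAt {𝕜 : Type*} [NontriviallyNormedField 𝕜]
    [CompleteSpace 𝕜] {f : 𝕜 → 𝕜} {f' x : 𝕜} (hf : HasStrictDerivAt f f' x) (hne : f' ≠ 0) :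
    ∃ V : Set 𝕜, IsOpen V ∧ x ∈ V ∧ InjOn f V := by
  have h := hf.hasStrictFDerivAt_equiv hne
  exact ⟨(h.toOpenPartialHomeomorph f).source, (h.toOpenPartialHomeomorph f).open_source,
    h.mem_toOpenPartialHomeomorph_source, (h.toOpenPartialHomeomorph f).injOn⟩

lemma exists_countable_injOn_cover {X Y : Type*} [TopologicalSpace X]
    [SecondCountableTopology X] {f : X → Y} {s : Set X}
    (h : ∀ x ∈ s, ∃ V : Set X, IsOpen V ∧ x ∈ V ∧ InjOn f V) :
    ∃ V : ℕ → Set X, (∀ n, IsOpen (V n)) ∧ (∀ n, InjOn f (V n)) ∧ s ⊆ ⋃ n, V n := by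
  choose! W hWo hWm hWi using h
  obtain ⟨t, hts, htc, hcov⟩ := TopologicalSpace.countable_cover_nhdsWithin
    fun x hx => mem_nhdsWithin_of_mem_nhds ((hWo x hx).mem_nhds (hWm x hx))
  rcases t.eq_empty_or_nonempty with rfl | hne
  · exact ⟨fun _ => ∅, fun _ => isOpen_empty, fun _ => injOn_empty _, by simpa using hcov⟩
  · obtain ⟨g, rfl⟩ := htc.exists_eq_range hne
    exact ⟨fun n => W (g n), fun n => hWo _ (hts ⟨n, rfl⟩), fun n => hWi _ (hts ⟨n, rfl⟩),
      by simpa using hcov⟩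

lemma ofReal_abs_det_restrictScalars {E : Type*} [AddCommGroup E] [Module ℂ E] (f : E →ₗ[ℂ] E) :
    ENNReal.ofReal |LinearMap.det (f.restrictScalars ℝ)| = ‖LinearMap.det f‖ₑ ^ 2 := by
  rw [LinearMap.det_restrictScalars, Algebra.norm_complex_eq]
  simp [Complex.normSq_eq_norm_sq, ENNReal.ofReal_pow]

theorem lintegral_enorm_deriv_sq_mul {f f' : ℂ → ℂ} {s : Set ℂ} (hs : MeasurableSet s)
    (hf : ∀ x ∈ s, HasStrictDerivAt f (f' x) x) (hne : ∀ x ∈ s, f' x ≠ 0) {h : ℂ → ℝ≥0∞}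
    (hh : Measurable h) :
    ∫⁻ x in s, ‖f' x‖ₑ ^ 2 * h (f x) = ∫⁻ a, Measure.count (s ∩ f ⁻¹' {a}) * h a := by
  obtain ⟨V, hVo, hVi, hsV⟩ := exists_countable_injOn_cover (f := f) (s := s)
    fun x hx => exists_isOpen_injOn_of_hasStrictDerivAt (hf x hx) (hne x hx)
  rw [← lintegral_abs_det_fderiv_mul_of_countable_injOn hs
    (fun x hx => ((hf x hx).hasDerivAt.hasFDerivAt.restrictScalars ℝ).hasFDerivWithinAt)
    (fun n => (hVo n).measurableSet) hVi hsV hh]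
  refine lintegral_congr fun x => ?_
  have := ofReal_abs_det_restrictScalars
    (ContinuousLinearMap.toSpanSingleton ℂ (f' x) : ℂ →ₗ[ℂ] ℂ)
  rw [LinearMap.det_ring] at this
  simpa [ContinuousLinearMap.det] using congrArg (· * h (f x)) this.symm

lemma eval_ne_zero_of_isCoprime_of_eval_sub_eq_zero {K : Type*} [Field K] {P Q : K[X]}
    (hPQ : IsCoprime P Q) {a x : K} (hx : (P - C a * Q).eval x = 0) : Q.eval x ≠ 0 := by
  obtain ⟨u, v, huv⟩ := hPQ
  intro hQ
  simpa [show P.eval x = 0 by simpa [hQ] using hx, hQ] using congrArg (eval x) huv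

section Rational

variable {K : Type*} [Field K] [IsAlgClosed K] {P Q : K[X]}

lemma separable_sub_C_mul (hPQ : IsCoprime P Q) {a : K}
    (ha : ∀ x, (wronskian Q P).eval x = 0 → P.eval x / Q.eval x ≠ a) :
    (P - C a * Q).Separable := by
  rw [separable_def, isCoprime_iff_aeval_ne_zero_of_isAlgClosed K K]
  intro x
  simp only [coe_aeval_eq_eval]
  by_contra! h
  have hQ := eval_ne_zero_of_isCoprime_of_eval_sub_eq_zero hPQ h.1
  simp only [eval_sub, eval_mul, eval_C, derivative_sub, derivative_C_mul, sub_eq_zero] at h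
  refine ha x ?_ ((div_eq_iff hQ).2 h.1)
  simp only [wronskian, eval_sub, eval_mul, h.1, h.2]
  ring

lemma encard_fibre_div (hP : P.Monic) (hdeg : Q.degree < P.degree)
    (hPQ : IsCoprime P Q) {a : K}
    (ha : ∀ x, (wronskian Q P).eval x = 0 → P.eval x / Q.eval x ≠ a) :
    {x | Q.eval x ≠ 0 ∧ P.eval x / Q.eval x = a}.encard = P.natDegree := by
  classical
  have hdeg' : (C a * Q).degree < P.degree := by
    rw [← smul_eq_C_mul]
    exact (degree_smul_le a Q).trans_lt hdeg
  have hroots : {x | Q.eval x ≠ 0 ∧ P.eval x / Q.eval x = a} = (P - C a * Q).rootSet K := by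
    ext x
    rw [mem_rootSet, coe_aeval_eq_eval]
    constructor
    · rintro ⟨hQ, h⟩
      rw [div_eq_iff hQ] at h
      exact ⟨(hP.sub_of_left hdeg').ne_zero, by simp [h]⟩
    · rintro ⟨-, h⟩
      have hQ := eval_ne_zero_of_isCoprime_of_eval_sub_eq_zero hPQ h
      simp only [eval_sub, eval_mul, eval_C, sub_eq_zero] at h
      exact ⟨hQ, (div_eq_iff hQ).2 h⟩
  rw [hroots, ← natDegree_eq_of_degree_eq (degree_sub_eq_left_of_degree_lt hdeg'),
    ← card_rootSet_eq_natDegree (K := K) (separable_sub_C_mul hPQ ha) (IsAlgClosed.splits _),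
    encard_eq_coe_toFinset_card, toFinset_card]

end Rational

section ComplexRational

variable {P Q : ℂ[X]}

lemma wronskian_ne_zero {K : Type*} [Field K] [CharZero K] {P Q : K[X]} (hPQ : IsCoprime P Q)
    (hP : 0 < P.natDegree) : wronskian Q P ≠ 0 := fun h =>
  hP.ne' (derivative_eq_zero.1 (hPQ.symm.wronskian_eq_zero_iff.1 h).2)

lemma ae_forall_wronskian_eval_ne_zero (hPQ : IsCoprime P Q) (hP : 0 < P.natDegree) :
    ∀ᵐ a : ℂ, ∀ x, (wronskian Q P).eval x = 0 → P.eval x / Q.eval x ≠ a := by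
  have hcritical : ((fun x => P.eval x / Q.eval x) '' {x | (wronskian Q P).IsRoot x}).Finite :=
    (finite_setOfPred_isRoot (wronskian_ne_zero hPQ hP)).image _
  filter_upwards [compl_mem_ae_iff.2 (hcritical.measure_zero volume)] with a ha x hx hxa
  exact ha ⟨x, hx, hxa⟩

lemma ae_separable_sub_C_mul (hPQ : IsCoprime P Q) (hP : 0 < P.natDegree) :
    ∀ᵐ a : ℂ, (P - C a * Q).Separable := by
  filter_upwards [ae_forall_wronskian_eval_ne_zero hPQ hP] with a ha
  exact separable_sub_C_mul hPQ ha

theorem lintegral_enorm_deriv_div_sq_mul (hP : P.Monic) (hP0 : 0 < P.natDegree)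
    (hdeg : Q.degree < P.degree) (hQ : Q ≠ 0) (hPQ : IsCoprime P Q) {h : ℂ → ℝ≥0∞}
    (hh : Measurable h) :
    ∫⁻ x, ‖(wronskian Q P).eval x / Q.eval x ^ 2‖ₑ ^ 2 * h (P.eval x / Q.eval x) =
      P.natDegree * ∫⁻ a, h a := by
  set U : Set ℂ := {x | Q.eval x ≠ 0 ∧ (wronskian Q P).eval x ≠ 0}
  have hUc : Uᶜ.Finite :=
    ((finite_setOfPred_isRoot hQ).union
      (finite_setOfPred_isRoot (wronskian_ne_zero hPQ hP0))).subset fun x hx => by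
        simpa [U, or_iff_not_imp_left] using hx
  have hUae : ∀ᵐ x : ℂ, x ∈ U := compl_compl U ▸ compl_mem_ae_iff.2 (hUc.measure_zero volume)
  have hderiv x (hx : x ∈ U) : HasStrictDerivAt (fun x => P.eval x / Q.eval x)
      ((wronskian Q P).eval x / Q.eval x ^ 2) x := by
    convert! (P.hasStrictDerivAt x).div (Q.hasStrictDerivAt x) hx.1 using 2
    simp only [wronskian, eval_sub, eval_mul]
    ring
  have harea := lintegral_enorm_deriv_sq_mul (compl_compl U ▸ hUc.measurableSet.compl) hderiv
    (fun x hx => div_ne_zero hx.2 (pow_ne_zero 2 hx.1)) hh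
  rw [Measure.restrict_eq_self_of_ae_mem hUae] at harea
  rw [harea, ← lintegral_const_mul _ hh]
  refine lintegral_congr_ae ?_
  filter_upwards [ae_forall_wronskian_eval_ne_zero hPQ hP0] with a ha
  have hfibre : U ∩ (fun x => P.eval x / Q.eval x) ⁻¹' {a} =
      {x | Q.eval x ≠ 0 ∧ P.eval x / Q.eval x = a} :=
    Set.ext fun x => ⟨fun hx => ⟨hx.1.1, hx.2⟩, fun hx => ⟨⟨hx.1, fun hw => ha x hw hx.2⟩, hx.2⟩⟩
  rw [hfibre, Measure.count_apply, encard_fibre_div hP hdeg hPQ ha]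
  · simp
  · exact (finite_of_encard_eq_coe (encard_fibre_div hP hdeg hPQ ha)).measurableSet

theorem map_pow_withDensity {d : ℕ} (hd : 0 < d) :
    Measure.map (fun z : ℂ => z ^ d) (volume.withDensity fun z => ‖(d : ℂ) * z ^ (d - 1)‖ₑ ^ 2) =
      (d : ℝ≥0∞) • volume := by
  ext s hs
  have hpow : Measurable fun z : ℂ => z ^ d := by fun_prop
  have harea := lintegral_enorm_deriv_div_sq_mul (P := X ^ d) (Q := 1) (monic_X_pow d)
    (by simpa using hd) (by simpa using hd) one_ne_zero isCoprime_one_right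
    (measurable_one.indicator hs)
  simp only [natDegree_X_pow, lintegral_indicator_one hs] at harea
  rw [Measure.map_apply hpow hs, withDensity_apply _ (hpow hs), Measure.smul_apply, smul_eq_mul,
    ← harea, ← lintegral_indicator (hpow hs)]
  refine lintegral_congr fun z => ?_
  by_cases hz : z ^ d ∈ s <;> simp [hz, wronskian, derivative_X_pow]

theorem integral_comp_pow {F : Type*} [NormedAddCommGroup F] [NormedSpace ℝ F] {d : ℕ}
    (hd : 0 < d) {g : ℂ → F} (hg : StronglyMeasurable g) :
    ∫ z : ℂ, ‖(d : ℂ) * z ^ (d - 1)‖ ^ 2 • g (z ^ d) = (d : ℝ) • ∫ w, g w := by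
  have hpow : Measurable fun z : ℂ => z ^ d := by fun_prop
  have h := congrArg (fun μ => ∫ w, g w ∂μ) (map_pow_withDensity hd)
  simp only [integral_smul_measure, ENNReal.toReal_natCast] at h
  rw [integral_map hpow.aemeasurable hg.aestronglyMeasurable,
    integral_withDensity_eq_integral_toReal_smul (by fun_prop)
      (.of_forall fun z => ENNReal.pow_lt_top enorm_lt_top)] at h
  simpa using h

end ComplexRational

end AreaFormula

section Andreief

open scoped ComplexConjugate Matrix

section General

lemma det_mul_det_eq_sum {α ι R : Type*} [Fintype ι] [DecidableEq ι] [CommRing R]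
    (φ ψ : ι → α → R) (x : ι → α) :
    (Matrix.of fun i j => φ i (x j)).det * (Matrix.of fun i j => ψ i (x j)).det =
      ∑ σ : Equiv.Perm ι, ∑ τ : Equiv.Perm ι,
        ((σ.sign : R) * (τ.sign : R)) * ∏ i, (φ (σ i) (x i) * ψ (τ i) (x i)) := by
  simp_rw [Matrix.det_apply', Finset.sum_mul_sum, Finset.prod_mul_distrib, Matrix.of_apply]
  exact Finset.sum_congr rfl fun σ _ => Finset.sum_congr rfl fun τ _ => by ring

variable {α ι 𝕜 : Type*} [MeasurableSpace α] {μ : Measure α} [SigmaFinite μ] [Fintype ι]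
  [DecidableEq ι] [RCLike 𝕜] {φ ψ : ι → α → 𝕜}

lemma integrable_prod_mul_comp (h : ∀ i j, Integrable (fun x => φ i x * ψ j x) μ)
    (σ τ : Equiv.Perm ι) :
    Integrable (fun x : ι → α => ((σ.sign : 𝕜) * (τ.sign : 𝕜)) *
      ∏ i, (φ (σ i) (x i) * ψ (τ i) (x i))) (Measure.pi fun _ => μ) :=
  (Integrable.fintype_prod (f := fun i x => φ (σ i) x * ψ (τ i) x)
    fun i => h (σ i) (τ i)).const_mul _

theorem integrable_det_mul_det (h : ∀ i j, Integrable (fun x => φ i x * ψ j x) μ) :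
    Integrable (fun x : ι → α =>
      (Matrix.of fun i j => φ i (x j)).det * (Matrix.of fun i j => ψ i (x j)).det)
      (Measure.pi fun _ => μ) := by
  simp_rw [det_mul_det_eq_sum]
  exact integrable_finsetSum _ fun σ _ => integrable_finsetSum _ fun τ _ =>
    integrable_prod_mul_comp h σ τ

/-- Andréief's identity. -/
theorem integral_det_mul_det (h : ∀ i j, Integrable (fun x => φ i x * ψ j x) μ) :
    ∫ x : ι → α, (Matrix.of fun i j => φ i (x j)).det * (Matrix.of fun i j => ψ i (x j)).det
        ∂(Measure.pi fun _ => μ) =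
      (Fintype.card ι).factorial * (Matrix.of fun i j => ∫ x, φ i x * ψ j x ∂μ).det := by
  set M : Matrix ι ι 𝕜 := Matrix.of fun i j => ∫ x, φ i x * ψ j x ∂μ
  have hσ (σ : Equiv.Perm ι) :
      ∑ τ : Equiv.Perm ι, ((σ.sign : 𝕜) * (τ.sign : 𝕜)) * ∏ i, M (σ i) (τ i) = M.det := by
    calc _ = (σ.sign : 𝕜) * (M.submatrix σ id)ᵀ.det := by
          rw [Matrix.det_apply', Finset.mul_sum]
          exact Finset.sum_congr rfl fun τ _ => mul_assoc _ _ _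
      _ = M.det := by
          rw [Matrix.det_transpose, Matrix.det_permute, ← mul_assoc]
          rcases Int.units_eq_one_or σ.sign with hs | hs <;> simp [hs]
  calc _ = ∑ σ : Equiv.Perm ι, ∑ τ : Equiv.Perm ι,
        ((σ.sign : 𝕜) * (τ.sign : 𝕜)) * ∏ i, M (σ i) (τ i) := by
        simp_rw [det_mul_det_eq_sum]
        rw [integral_finsetSum _ fun σ _ => integrable_finsetSum _ fun τ _ =>
          integrable_prod_mul_comp h σ τ]
        refine Finset.sum_congr rfl fun σ _ => ?_
        rw [integral_finsetSum _ fun τ _ => integrable_prod_mul_comp h σ τ]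
        refine Finset.sum_congr rfl fun τ _ => ?_
        rw [integral_const_mul, integral_fintype_prod_eq_prod (fun i x => φ (σ i) x * ψ (τ i) x)]
        rfl
    _ = _ := by simp [hσ, Fintype.card_perm]

end General

/-- The unnormalised joint density `∏ⱼ w(zⱼ) ∏_{i<j} |zⱼ - zᵢ|²` of the determinantal point
process with `n` points and one-particle weight `w`; the density `weight n V` is the case
`w = exp (-n V)`. -/
noncomputable def vandermondeWeight {n : ℕ} (w : ℂ → ℝ) (z : Fin n → ℂ) : ℝ :=
  (∏ j, w (z j)) * ∏ i, ∏ j ∈ Finset.Ioi i, ‖z j - z i‖ ^ 2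

/-- The moment `∫ zʲ z̄ᵏ w(z) d²z` of the weight `w`. -/
noncomputable def moment (w : ℂ → ℝ) (j k : ℕ) : ℂ :=
  ∫ z : ℂ, z ^ j * conj z ^ k * (w z : ℂ)

/-- All the moments of the weight `w` are given by convergent integrals. -/
def HasFiniteMoments (w : ℂ → ℝ) : Prop :=
  ∀ j k : ℕ, Integrable fun z : ℂ => z ^ j * conj z ^ k * (w z : ℂ)

lemma weight_eq_vandermondeWeight (n : ℕ) (V : ℂ → ℝ) :
    weight n V = vandermondeWeight fun z => Real.exp (-(n : ℝ) * V z) := rfl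

variable {n : ℕ} {w : ℂ → ℝ}

lemma vandermondeWeight_nonneg (hw : ∀ z, 0 ≤ w z) (z : Fin n → ℂ) : 0 ≤ vandermondeWeight w z :=
  mul_nonneg (Finset.prod_nonneg fun _ _ => hw _)
    (Finset.prod_nonneg fun _ _ => Finset.prod_nonneg fun _ _ => sq_nonneg _)

lemma ofReal_vandermondeWeight (z : Fin n → ℂ) :
    ((vandermondeWeight w z : ℝ) : ℂ) =
      (Matrix.of fun i j : Fin n => z j ^ (i : ℕ)).det *
        (Matrix.of fun i j : Fin n => conj (z j) ^ (i : ℕ) * (w (z j) : ℂ)).det := by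
  have hV (v : Fin n → ℂ) : (Matrix.of fun i j : Fin n => v j ^ (i : ℕ)).det =
      ∏ i, ∏ j ∈ Finset.Ioi i, (v j - v i) := by
    rw [← Matrix.det_vandermonde, ← Matrix.det_transpose]
    rfl
  have hw : (Matrix.of fun i j : Fin n => conj (z j) ^ (i : ℕ) * (w (z j) : ℂ)).det =
      (∏ j, (w (z j) : ℂ)) * (Matrix.of fun i j : Fin n => conj (z j) ^ (i : ℕ)).det := by
    rw [← Matrix.det_mul_row]
    simp_rw [mul_comm, Matrix.of_apply]
  rw [hw, hV, hV fun j => conj (z j), vandermondeWeight, mul_left_comm]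
  push_cast
  simp_rw [← Finset.prod_mul_distrib, ← map_sub, Complex.mul_conj, Complex.normSq_eq_norm_sq]
  push_cast
  rfl

theorem HasFiniteMoments.integrable_vandermondeWeight (hw : HasFiniteMoments w) :
    Integrable (vandermondeWeight (n := n) w) := by
  have h := integrable_det_mul_det (ι := Fin n) (φ := fun j z => z ^ (j : ℕ))
    (ψ := fun k z => conj z ^ (k : ℕ) * (w z : ℂ)) fun j k => by simpa only [mul_assoc] using hw j k
  simp_rw [← ofReal_vandermondeWeight] at h
  exact h.re

theorem HasFiniteMoments.integral_vandermondeWeight (hw : HasFiniteMoments w) :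
    ((∫ z : Fin n → ℂ, vandermondeWeight w z : ℝ) : ℂ) =
      n.factorial * (Matrix.of fun j k : Fin n => moment w j k).det := by
  have h := integral_det_mul_det (ι := Fin n) (φ := fun j z => z ^ (j : ℕ))
    (ψ := fun k z => conj z ^ (k : ℕ) * (w z : ℂ)) fun j k => by simpa only [mul_assoc] using hw j k
  simp_rw [← ofReal_vandermondeWeight, ← mul_assoc, Fintype.card_fin] at h
  rw [← integral_complex_ofReal]
  exact h

lemma vandermondeWeight_mul_left (c : ℝ) (w : ℂ → ℝ) (z : Fin n → ℂ) :
    vandermondeWeight (fun x => c * w x) z = c ^ n * vandermondeWeight w z := by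
  simp [vandermondeWeight, Finset.prod_mul_distrib, mul_assoc]

end Andreief

section Moments

open scoped ComplexConjugate

variable {w : ℂ → ℝ}

lemma integrable_norm_rpow_mul_exp {p q b : ℝ} (hp : 1 ≤ p) (hq : -2 < q) (hb : 0 < b) :
    Integrable fun z : ℂ => ‖z‖ ^ q * Real.exp (-b * ‖z‖ ^ p) := by
  have hΓ : 0 < Real.Gamma ((q + 2) / p) :=
    Real.Gamma_pos_of_pos (div_pos (by linarith) (by linarith))
  refine Integrable.of_integral_ne_zero ?_
  rw [Complex.integral_rpow_mul_exp_neg_mul_rpow hp hq hb]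
  positivity

lemma hasFiniteMoments_of_abs_le (hw : Measurable w) {C γ b p : ℝ} {a : ℂ} (hp : 1 ≤ p)
    (hγ : -2 < γ) (hb : 0 < b)
    (hle : ∀ z, |w z| ≤ C * (‖z - a‖ ^ γ * Real.exp (-b * ‖z - a‖ ^ p))) :
    HasFiniteMoments w := by
  intro j k
  have hexp (m : ℕ) :
      Integrable fun z : ℂ => ‖z - a‖ ^ (m + γ) * Real.exp (-b * ‖z - a‖ ^ p) :=
    (integrable_norm_rpow_mul_exp hp (by linarith [m.cast_nonneg (α := ℝ)]) hb).comp_sub_right a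
  have hmeas : Measurable fun z : ℂ => z ^ j * conj z ^ k * (w z : ℂ) := by fun_prop
  refine (((hexp (j + k)).add ((hexp 0).const_mul (‖a‖ ^ (j + k)))).const_mul
    (2 ^ (j + k - 1) * C)).mono' hmeas.aestronglyMeasurable ?_
  filter_upwards [Measure.ae_ne volume a] with z hz
  have hza : 0 < ‖z - a‖ := norm_pos_iff.2 (sub_ne_zero.2 hz)
  calc ‖z ^ j * conj z ^ k * (w z : ℂ)‖ = ‖z‖ ^ (j + k) * |w z| := by
        simp [pow_add]
    _ ≤ (2 ^ (j + k - 1) * (‖z - a‖ ^ (j + k) + ‖a‖ ^ (j + k))) *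
          (C * (‖z - a‖ ^ γ * Real.exp (-b * ‖z - a‖ ^ p))) := by
        refine mul_le_mul ?_ (hle z) (abs_nonneg _) (by positivity)
        refine le_trans ?_ (add_pow_le (norm_nonneg _) (norm_nonneg _) _)
        gcongr
        simpa using norm_add_le (z - a) a
    _ = _ := by
        simp only [Pi.add_apply, Real.rpow_add hza, Real.rpow_natCast, pow_zero]
        ring

lemma moment_eq_zero_of_rotation {ω : ℂ} (hω : ‖ω‖ = 1) (hw : ∀ z, w (ω * z) = w z) {j k : ℕ}
    (hjk : ω ^ j ≠ ω ^ k) : moment w j k = 0 := by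
  let u : Circle := ⟨ω, by simpa [Submonoid.unitSphere] using hω⟩
  have hinv : moment w j k = ω ^ j * conj ω ^ k * moment w j k := by
    calc moment w j k = ∫ z : ℂ, (ω * z) ^ j * conj (ω * z) ^ k * (w (ω * z) : ℂ) :=
          ((rotation u).measurePreserving.integral_comp
            (rotation u).toHomeomorph.measurableEmbedding
            fun z : ℂ => z ^ j * conj z ^ k * (w z : ℂ)).symm
      _ = ∫ z : ℂ, ω ^ j * conj ω ^ k * (z ^ j * conj z ^ k * (w z : ℂ)) := by
          simp only [hw, map_mul, mul_pow]
          exact integral_congr_ae (ae_of_all _ fun z => by ring)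
      _ = ω ^ j * conj ω ^ k * moment w j k := integral_const_mul _ _
  have hωk : ω ^ k * conj ω ^ k = 1 := by
    rw [← mul_pow, Complex.mul_conj, Complex.normSq_eq_norm_sq, hω]
    simp
  by_contra hne
  exact hjk (mul_right_cancel₀ (right_ne_zero_of_mul_eq_one hωk)
    ((mul_eq_right₀ hne).1 hinv.symm |>.trans hωk.symm))

lemma moment_eq_zero_of_mod_ne {m : ℕ} (hm : m ≠ 0)
    (hw : ∀ ω z : ℂ, ω ^ m = 1 → w (ω * z) = w z) {j k : ℕ} (hjk : j % m ≠ k % m) :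
    moment w j k = 0 := by
  have hprim := Complex.isPrimitiveRoot_exp m hm
  refine moment_eq_zero_of_rotation (Complex.norm_eq_one_of_pow_eq_one hprim.pow_eq_one hm)
    (fun z => hw _ z hprim.pow_eq_one) fun h => hjk ?_
  rw [← pow_mod_orderOf _ j, ← pow_mod_orderOf _ k, ← hprim.eq_orderOf] at h
  have hm' := Nat.pos_of_ne_zero hm
  exact hprim.pow_inj (Nat.mod_lt _ hm') (Nat.mod_lt _ hm') h

end Moments

section Charge

open scoped ComplexConjugate

/-- The Gaussian weight `exp (-s |z - b|²)` with a point charge `|z - a| ^ γ` inserted at `a`. -/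
noncomputable def chargeWeight (γ s : ℝ) (a b z : ℂ) : ℝ :=
  ‖z - a‖ ^ γ * Real.exp (-s * ‖z - b‖ ^ 2)

variable {n : ℕ} {γ s : ℝ} {a b : ℂ}

lemma chargeWeight_zero (s : ℝ) (a b : ℂ) :
    chargeWeight 0 s a b = fun z => Real.exp (-s * ‖z - b‖ ^ 2) := by
  simp only [funext_iff, chargeWeight, Real.rpow_zero, one_mul, implies_true]

lemma chargeWeight_nonneg (z : ℂ) : 0 ≤ chargeWeight γ s a b z := by
  unfold chargeWeight
  positivity

@[fun_prop]
lemma measurable_chargeWeight : Measurable (chargeWeight γ s a b) := by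
  unfold chargeWeight
  fun_prop

lemma half_norm_sq_sub_norm_sq_le {E : Type*} [SeminormedAddCommGroup E] (x y : E) :
    ‖x‖ ^ 2 / 2 - ‖y‖ ^ 2 ≤ ‖x - y‖ ^ 2 := by
  have h : ‖x‖ ^ 2 ≤ (‖x - y‖ + ‖y‖) ^ 2 := by
    gcongr
    simpa using norm_add_le (x - y) y
  nlinarith [sq_nonneg (‖x - y‖ - ‖y‖)]

lemma hasFiniteMoments_chargeWeight (hγ : -2 < γ) (hs : 0 < s) :
    HasFiniteMoments (chargeWeight γ s a b) := by
  refine hasFiniteMoments_of_abs_le measurable_chargeWeight (C := Real.exp (s * ‖b - a‖ ^ 2))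
    (a := a) (b := s / 2) (p := 2) one_le_two hγ (by positivity) fun z => ?_
  rw [chargeWeight, abs_of_nonneg (by positivity), mul_left_comm, ← Real.exp_add, Real.rpow_two]
  gcongr
  have h := half_norm_sq_sub_norm_sq_le (z - a) (b - a)
  rw [sub_sub_sub_cancel_right] at h
  nlinarith

lemma chargeWeight_comp_affine {R : ℝ} (hR : R ≠ 0) (c z : ℂ) :
    chargeWeight γ s a b (c + R • z) =
      |R| ^ γ * chargeWeight γ (s * R ^ 2) (R⁻¹ • (a - c)) (R⁻¹ • (b - c)) z := by
  have hsub (e : ℂ) : ‖c + R • z - e‖ = |R| * ‖z - R⁻¹ • (e - c)‖ := by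
    rw [← Real.norm_eq_abs, ← norm_smul, smul_sub, smul_inv_smul₀ hR]
    congr 1
    ring
  rw [chargeWeight, chargeWeight, hsub, hsub, Real.mul_rpow (abs_nonneg R) (norm_nonneg _), mul_pow,
    sq_abs]
  ring_nf

lemma vandermondeWeight_comp_affine (w : ℂ → ℝ) (c : ℂ) (R : ℝ) (z : Fin n → ℂ) :
    vandermondeWeight w ((fun _ => c) + R • z) =
      |R| ^ (n * (n - 1)) * vandermondeWeight (fun x => w (c + R • x)) z := by
  have hcard : ∑ i : Fin n, 2 * (Finset.Ioi i).card = n * (n - 1) := by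
    simp_rw [Fin.card_Ioi]
    rw [← Finset.mul_sum, Fin.sum_univ_eq_sum_range (fun i => n - 1 - i),
      Finset.sum_range_reflect fun i => i, mul_comm, Finset.sum_range_id_mul_two]
  simp only [vandermondeWeight, Pi.add_apply, Pi.smul_apply, add_sub_add_left_eq_sub, ← smul_sub,
    norm_smul, Real.norm_eq_abs, mul_pow, Finset.prod_mul_distrib, Finset.prod_const, ← pow_mul,
    Finset.prod_pow_eq_pow_sum, hcard]
  ring

theorem integral_vandermondeWeight_comp_affine (w : ℂ → ℝ) (c : ℂ) {R : ℝ} (hR : R ≠ 0) :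
    ∫ z : Fin n → ℂ, vandermondeWeight w z =
      |R| ^ (n * (n + 1)) *
        ∫ z : Fin n → ℂ, vandermondeWeight (fun x => w (c + R • x)) z := by
  have hfinrank : Module.finrank ℝ (Fin n → ℂ) = 2 * n := by
    simp [Module.finrank_pi_fintype, Complex.finrank_real_complex, mul_comm]
  have h := Measure.integral_comp_smul volume
    (fun z : Fin n → ℂ => vandermondeWeight w ((fun _ => c) + z)) R
  rw [integral_add_left_eq_self (μ := volume) (vandermondeWeight (n := n) w), hfinrank, abs_inv,
    abs_pow, smul_eq_mul, eq_inv_mul_iff_mul_eq₀ (by positivity)] at h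
  simp_rw [← h, vandermondeWeight_comp_affine, integral_const_mul, ← mul_assoc, ← pow_add]
  congr 2
  cases n <;> simp; ring

theorem integral_vandermondeWeight_chargeWeight_comp_affine (c : ℂ) {R : ℝ} (hR : R ≠ 0) :
    ∫ z : Fin n → ℂ, vandermondeWeight (chargeWeight γ s a b) z =
      |R| ^ ((n : ℝ) * (n + 1) + n * γ) * ∫ z : Fin n → ℂ,
        vandermondeWeight (chargeWeight γ (s * R ^ 2) (R⁻¹ • (a - c)) (R⁻¹ • (b - c))) z := by
  have hR' : 0 < |R| := abs_pos.2 hR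
  simp_rw [integral_vandermondeWeight_comp_affine (chargeWeight γ s a b) c hR,
    chargeWeight_comp_affine hR, vandermondeWeight_mul_left, integral_const_mul, ← mul_assoc]
  congr 1
  rw [Real.rpow_add hR', mul_comm (n : ℝ) γ, Real.rpow_mul_natCast hR'.le]
  norm_cast

end Charge

section Ginibre

open scoped ComplexConjugate

variable {s : ℝ}

lemma hasFiniteMoments_exp_neg_mul_norm_sq (hs : 0 < s) :
    HasFiniteMoments fun z => Real.exp (-s * ‖z‖ ^ 2) := by
  have h := hasFiniteMoments_chargeWeight (γ := 0) (a := 0) (b := 0) (by norm_num) hs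
  simpa only [chargeWeight_zero, sub_zero] using h

lemma moment_exp_neg_mul_norm_sq_self (hs : 0 < s) (j : ℕ) :
    moment (fun z => Real.exp (-s * ‖z‖ ^ 2)) j j =
      ((Real.pi * j.factorial / s ^ (j + 1) : ℝ) : ℂ) := by
  have hintegrand (z : ℂ) : z ^ j * conj z ^ j * (Real.exp (-s * ‖z‖ ^ 2) : ℂ) =
      ((‖z‖ ^ (2 * j : ℝ) * Real.exp (-s * ‖z‖ ^ (2 : ℝ)) : ℝ) : ℂ) := by
    rw [← mul_pow, Complex.mul_conj, Complex.normSq_eq_norm_sq, Real.rpow_mul (norm_nonneg z)]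
    push_cast
    simp
  have hj : -2 < (2 * j : ℝ) := by linarith [j.cast_nonneg (α := ℝ)]
  have hexp : -(2 * j + 2 : ℝ) / 2 = -((j + 1 : ℕ) : ℝ) := by push_cast; ring
  have hΓ : (2 * j + 2 : ℝ) / 2 = j + 1 := by ring
  rw [moment]
  simp_rw [hintegrand]
  rw [integral_complex_ofReal, Complex.integral_rpow_mul_exp_neg_mul_rpow one_le_two hj hs, hexp,
    hΓ, Real.Gamma_nat_eq_factorial, Real.rpow_neg hs.le, Real.rpow_natCast]
  congr 1
  field_simp

lemma moment_exp_neg_mul_norm_sq_of_ne (s : ℝ) {j k : ℕ} (hjk : j ≠ k) :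
    moment (fun z => Real.exp (-s * ‖z‖ ^ 2)) j k = 0 := by
  refine moment_eq_zero_of_mod_ne (m := j + k + 1) (by lia) (fun ω z hω => ?_) ?_
  · simp [Complex.norm_eq_one_of_pow_eq_one hω (by lia)]
  · rwa [Nat.mod_eq_of_lt (by lia), Nat.mod_eq_of_lt (by lia)]

theorem integral_vandermondeWeight_exp_neg_mul_norm_sq (n : ℕ) (hs : 0 < s) :
    ∫ z : Fin n → ℂ, vandermondeWeight (fun x => Real.exp (-s * ‖x‖ ^ 2)) z =
      Real.pi ^ n * (∏ k ∈ Finset.Icc 1 n, (k.factorial : ℝ)) /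
        s ^ ((n : ℝ) * (n + 1) / 2) := by
  have hmoments : (Matrix.of fun j k : Fin n => moment (fun z => Real.exp (-s * ‖z‖ ^ 2)) j k) =
      Matrix.diagonal fun j : Fin n =>
        ((Real.pi * (j : ℕ).factorial / s ^ ((j : ℕ) + 1) : ℝ) : ℂ) := by
    ext j k
    rcases eq_or_ne j k with rfl | hjk
    · simpa using moment_exp_neg_mul_norm_sq_self hs j
    · simpa [hjk] using moment_exp_neg_mul_norm_sq_of_ne s (Fin.val_injective.ne hjk)
  have hfactorial : ∏ k ∈ Finset.Icc 1 n, (k.factorial : ℝ) =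
      n.factorial * ∏ k ∈ Finset.range n, (k.factorial : ℝ) := by
    rw [mul_comm, ← Finset.prod_range_succ]
    exact_mod_cast (Nat.prod_Icc_factorial n).trans (Nat.prod_range_succ_factorial n).symm
  have hpow : s ^ ((n : ℝ) * (n + 1) / 2) = ∏ k ∈ Finset.range n, s ^ (k + 1) := by
    have hsum : (∑ k ∈ Finset.range n, (k + 1)) * 2 = n * (n + 1) := by
      simpa only [Finset.sum_range_succ', add_zero, Nat.add_sub_cancel, mul_comm n] using
        Finset.sum_range_id_mul_two (n + 1)
    rw [Finset.prod_pow_eq_pow_sum, ← Real.rpow_natCast, ← Nat.cast_succ, ← Nat.cast_mul, ← hsum]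
    simp
  have h := (hasFiniteMoments_exp_neg_mul_norm_sq hs).integral_vandermondeWeight (n := n)
  rw [hmoments, Matrix.det_diagonal, ← Complex.ofReal_prod, ← Complex.ofReal_natCast,
    ← Complex.ofReal_mul, Complex.ofReal_inj, Fin.prod_univ_eq_prod_range
      (fun j => Real.pi * (j.factorial : ℝ) / s ^ (j + 1)) n, Finset.prod_div_distrib,
    Finset.prod_mul_distrib, Finset.prod_const, Finset.card_range] at h
  rw [h, hfactorial, hpow]
  ring

lemma weight_ginibrePotential (N : ℕ) (a : ℂ) :
    weight N ginibrePotential = vandermondeWeight (chargeWeight 0 N a 0) := by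
  simp only [weight_eq_vandermondeWeight, chargeWeight_zero, ginibrePotential, sub_zero]

theorem integrable_weight_ginibrePotential {N : ℕ} (hN : 0 < N) :
    Integrable (weight N ginibrePotential) := by
  rw [weight_ginibrePotential N 0]
  exact (hasFiniteMoments_chargeWeight (by norm_num)
    (Nat.cast_pos.2 hN)).integrable_vandermondeWeight

theorem partitionFunction_ginibrePotential {N : ℕ} (hN : 0 < N) :
    partitionFunction N ginibrePotential = Real.pi ^ N *
      (∏ k ∈ Finset.Icc 1 N, (k.factorial : ℝ)) / (N : ℝ) ^ ((N : ℝ) * (N + 1) / 2) := by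
  rw [partitionFunction, weight_eq_vandermondeWeight]
  exact integral_vandermondeWeight_exp_neg_mul_norm_sq N (Nat.cast_pos.2 hN)

lemma partitionFunction_ginibrePotential_pos {N : ℕ} (hN : 0 < N) :
    0 < partitionFunction N ginibrePotential := by
  rw [partitionFunction_ginibrePotential hN]
  positivity

end Ginibre

section Reduction

open scoped ComplexConjugate

lemma det_of_eq_prod_det_of_mod {R : Type*} [CommRing R] {N d : ℕ} (f : ℕ → ℕ → R)
    (hf : ∀ j k, j % d ≠ k % d → f j k = 0) :
    (Matrix.of fun j k : Fin (N * d) => f j k).det =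
      ∏ ℓ : Fin d, (Matrix.of fun a b : Fin N => f (ℓ + d * a) (ℓ + d * b)).det := by
  rw [← Matrix.det_blockDiagonal, ← Matrix.det_submatrix_equiv_self finProdFinEquiv]
  congr 1
  ext ⟨a, ℓ⟩ ⟨b, ℓ'⟩
  rw [Matrix.blockDiagonal_apply]
  split_ifs with hℓ
  · change ℓ = ℓ' at hℓ
    subst hℓ
    rfl
  · refine hf _ _ ?_
    simpa [Nat.mod_eq_of_lt ℓ.2, Nat.mod_eq_of_lt ℓ'.2, ← Fin.ext_iff] using hℓ

variable {N d : ℕ} {w : ℂ → ℝ}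

lemma neg_two_lt_gammaExponent (hd : 0 < d) (ℓ : ℕ) : -2 < gammaExponent d ℓ := by
  have : 0 < ((ℓ : ℝ) + 1) / d := by positivity
  unfold gammaExponent
  linarith

lemma sum_gammaExponent (hd : 0 < d) :
    ∑ ℓ ∈ Finset.range d, gammaExponent d ℓ = 1 - d := by
  have hsum : (∑ ℓ ∈ Finset.range d, (ℓ : ℝ)) * 2 = d * (d - 1) := by
    have h := congrArg (Nat.cast (R := ℝ)) (Finset.sum_range_id_mul_two d)
    push_cast [Nat.cast_sub hd] at h
    exact h
  have hd0 : (d : ℝ) ≠ 0 := by positivity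
  simp only [gammaExponent, ← Finset.mul_sum, Finset.sum_sub_distrib, ← Finset.sum_div,
    Finset.sum_add_distrib, Finset.sum_const, Finset.card_range, nsmul_eq_mul, mul_one]
  field_simp
  linarith

/-- The exponent `γ_ℓ` compensates the Jacobian of `z ↦ z ^ d` up to the factor `|z| ^ (2ℓ)`. -/
lemma norm_jacobian_pow_mul_rpow_gammaExponent (hd : 0 < d) (ℓ : ℕ) {z : ℂ} (hz : z ≠ 0) :
    ‖(d : ℂ) * z ^ (d - 1)‖ ^ 2 * ‖z ^ d‖ ^ gammaExponent d ℓ = d ^ 2 * (‖z‖ ^ 2) ^ ℓ := by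
  have hz' : 0 < ‖z‖ := norm_pos_iff.2 hz
  rw [norm_mul, Complex.norm_natCast, mul_pow, mul_assoc, norm_pow, norm_pow, ← pow_mul, ← pow_mul,
    ← Real.rpow_natCast _ d, ← Real.rpow_mul hz'.le, ← Real.rpow_natCast, ← Real.rpow_natCast,
    ← Real.rpow_natCast, ← Real.rpow_add hz', gammaExponent]
  congr 2
  push_cast [Nat.cast_sub (show 1 ≤ d from hd)]
  field_simp
  ring

lemma moment_comp_pow (hd : 0 < d) (hw : Measurable w) (ℓ a b : ℕ) :
    moment (fun z => w (z ^ d)) (ℓ + d * a) (ℓ + d * b) =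
      (d : ℂ)⁻¹ * moment (fun u => ‖u‖ ^ gammaExponent d ℓ * w u) a b := by
  have hd0 : (d : ℂ) ≠ 0 := by exact_mod_cast hd.ne'
  have hmeas : Measurable fun u : ℂ =>
      u ^ a * conj u ^ b * ((‖u‖ ^ gammaExponent d ℓ * w u : ℝ) : ℂ) := by fun_prop
  have hintegrand : ∀ᵐ z : ℂ, ‖(d : ℂ) * z ^ (d - 1)‖ ^ 2 • ((z ^ d) ^ a * conj (z ^ d) ^ b *
        ((‖z ^ d‖ ^ gammaExponent d ℓ * w (z ^ d) : ℝ) : ℂ)) =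
      (d : ℂ) ^ 2 * (z ^ (ℓ + d * a) * conj z ^ (ℓ + d * b) * (w (z ^ d) : ℂ)) := by
    filter_upwards [Measure.ae_ne volume 0] with z hz
    have hJ := congrArg (Complex.ofReal) (norm_jacobian_pow_mul_rpow_gammaExponent hd ℓ hz)
    rw [← Complex.normSq_eq_norm_sq z, Complex.ofReal_mul, Complex.ofReal_mul, Complex.ofReal_pow,
      Complex.ofReal_pow _ ℓ, ← Complex.mul_conj, Complex.ofReal_pow (d : ℝ),
      Complex.ofReal_natCast] at hJ
    rw [Complex.real_smul, Complex.ofReal_mul, Complex.ofReal_pow, map_pow]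
    linear_combination (z ^ d) ^ a * (conj z ^ d) ^ b * (w (z ^ d) : ℂ) * hJ
  have h := integral_comp_pow hd hmeas.stronglyMeasurable
  rw [integral_congr_ae hintegrand, integral_const_mul, Complex.real_smul,
    Complex.ofReal_natCast] at h
  change (d : ℂ) ^ 2 * moment (fun z => w (z ^ d)) (ℓ + d * a) (ℓ + d * b) = (d : ℂ) * _ at h
  rw [eq_inv_mul_iff_mul_eq₀ hd0]
  refine mul_left_cancel₀ hd0 ?_
  rw [← mul_assoc, ← sq, h, moment]

/-- The moments of a `ℤ/d`-invariant weight couple only monomials of the same degree modulo `d`, so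
the moment determinant is a product of `d` determinants of size `N`. -/
theorem integral_vandermondeWeight_comp_pow (hd : 0 < d) (hw : Measurable w)
    (hwd : HasFiniteMoments fun z => w (z ^ d))
    (hwγ : ∀ ℓ, HasFiniteMoments fun u => ‖u‖ ^ gammaExponent d ℓ * w u) :
    ∫ z : Fin (N * d) → ℂ, vandermondeWeight (fun x => w (x ^ d)) z =
      (N * d).factorial * ∏ ℓ ∈ Finset.range d, (((d : ℝ) ^ N * N.factorial)⁻¹ *
        ∫ u : Fin N → ℂ, vandermondeWeight (fun x => ‖x‖ ^ gammaExponent d ℓ * w x) u) := by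
  have hoff (j k : ℕ) (hjk : j % d ≠ k % d) : moment (fun z => w (z ^ d)) j k = 0 :=
    moment_eq_zero_of_mod_ne hd.ne' (fun ω z hω => by rw [mul_pow, hω, one_mul]) hjk
  have hblock (ℓ : ℕ) : (Matrix.of fun a b : Fin N =>
      moment (fun z => w (z ^ d)) (ℓ + d * a) (ℓ + d * b)).det =
      (((d : ℝ) ^ N * N.factorial)⁻¹ * ∫ u : Fin N → ℂ,
        vandermondeWeight (fun x => ‖x‖ ^ gammaExponent d ℓ * w x) u : ℝ) := by
    have hN : (N.factorial : ℂ) ≠ 0 := by exact_mod_cast N.factorial_ne_zero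
    simp_rw [moment_comp_pow hd hw, Complex.ofReal_mul, (hwγ ℓ).integral_vandermondeWeight]
    change ((d : ℂ)⁻¹ • Matrix.of fun a b : Fin N =>
      moment (fun u => ‖u‖ ^ gammaExponent d ℓ * w u) a b).det = _
    rw [Matrix.det_smul, Fintype.card_fin, inv_pow]
    push_cast
    field_simp
  refine Complex.ofReal_injective ?_
  rw [hwd.integral_vandermondeWeight, det_of_eq_prod_det_of_mod _ hoff, Complex.ofReal_mul,
    Complex.ofReal_prod, Complex.ofReal_natCast, ← Fin.prod_univ_eq_prod_range]
  simp_rw [hblock]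

lemma lemniscatePotential_eq (d : ℕ) (t : ℝ) (z : ℂ) :
    lemniscatePotential d t z = ‖z ^ d - t‖ ^ 2 - t ^ 2 := by
  rw [lemniscatePotential, ← Complex.normSq_eq_norm_sq, Complex.normSq_sub, pow_mul', ← norm_pow,
    ← Complex.normSq_eq_norm_sq, ← map_pow, Complex.add_re, Complex.conj_re, Complex.conj_ofReal,
    Complex.re_mul_ofReal, Complex.normSq_ofReal]
  ring

lemma weight_lemniscatePotential (N d : ℕ) (t : ℝ) (z : Fin (N * d) → ℂ) :
    weight (N * d) (lemniscatePotential d t) z = Real.exp ((N * t * d) ^ 2) *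
      vandermondeWeight (fun x => Real.exp (-(N * d : ℕ) * ‖x ^ d - t‖ ^ 2)) z := by
  have hexp (x : ℂ) : Real.exp (-(N * d : ℕ) * lemniscatePotential d t x) =
      Real.exp ((N * d : ℕ) * t ^ 2) * Real.exp (-(N * d : ℕ) * ‖x ^ d - t‖ ^ 2) := by
    rw [lemniscatePotential_eq, ← Real.exp_add]
    ring_nf
  simp_rw [weight_eq_vandermondeWeight, hexp]
  rw [vandermondeWeight_mul_left, ← Real.exp_nat_mul]
  congr 2
  push_cast
  ring

lemma hasFiniteMoments_exp_neg_mul_norm_pow_sub_sq {s : ℝ} (hs : 0 < s) (hd : 0 < d) (b : ℂ) :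
    HasFiniteMoments fun z => Real.exp (-s * ‖z ^ d - b‖ ^ 2) := by
  have hd' : (1 : ℝ) ≤ d := by exact_mod_cast hd
  refine hasFiniteMoments_of_abs_le (by fun_prop) (C := Real.exp (s * ‖b‖ ^ 2)) (a := 0)
    (γ := 0) (b := s / 2) (p := 2 * d) (by linarith) (by norm_num) (by positivity) fun z => ?_
  have hpow : ‖z‖ ^ (2 * d : ℝ) = ‖z ^ d‖ ^ 2 := by
    rw [norm_pow, ← pow_mul', ← Real.rpow_natCast]
    push_cast
    rfl
  rw [sub_zero, hpow, abs_of_pos (Real.exp_pos _), Real.rpow_zero, one_mul, ← Real.exp_add]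
  gcongr
  nlinarith [half_norm_sq_sub_norm_sq_le (z ^ d) b]

theorem integrable_weight_lemniscatePotential (hN : 0 < N) (hd : 0 < d) (t : ℝ) :
    Integrable (weight (N * d) (lemniscatePotential d t)) := by
  have hs : (0 : ℝ) < (N * d : ℕ) := by positivity
  rw [funext (weight_lemniscatePotential N d t)]
  exact (hasFiniteMoments_exp_neg_mul_norm_pow_sub_sq hs hd t).integrable_vandermondeWeight
    |>.const_mul _

lemma integral_vandermondeWeight_chargeWeight_recenter (hd : 0 < d) (γ t : ℝ) :
    ∫ u : Fin N → ℂ, vandermondeWeight (chargeWeight γ (N * d : ℕ) 0 t) u =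
      (d : ℝ) ^ (-((N : ℝ) * (N + 1 + γ) / 2)) *
        ∫ z : Fin N → ℂ, vandermondeWeight (chargeWeight γ N (t * Real.sqrt d : ℝ) 0) z := by
  have hd0 : (0 : ℝ) < d := by positivity
  have hsqrt : 0 < Real.sqrt d := Real.sqrt_pos.2 hd0
  rw [integral_vandermondeWeight_chargeWeight_comp_affine (t : ℂ)
    (neg_ne_zero.2 (inv_ne_zero hsqrt.ne'))]
  congr 1
  · rw [abs_neg, abs_inv, abs_of_pos hsqrt, Real.sqrt_eq_rpow, ← Real.rpow_neg hd0.le,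
      ← Real.rpow_mul hd0.le]
    ring_nf
  · rw [neg_sq, inv_pow, Real.sq_sqrt hd0.le, inv_neg, inv_inv, zero_sub, smul_neg, neg_smul,
      neg_neg, sub_self, smul_zero, Complex.real_smul, ← Complex.ofReal_mul, mul_comm _ t,
      Nat.cast_mul, mul_assoc, mul_inv_cancel₀ hd0.ne', mul_one]

theorem partitionFunction_lemniscatePotential (hN : 0 < N) (hd : 0 < d) (t : ℝ) :
    partitionFunction (N * d) (lemniscatePotential d t) =
      Real.exp ((N * t * d) ^ 2) * reductionConstant N d * ∏ ℓ ∈ Finset.range d,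
        ∫ z : Fin N → ℂ,
          vandermondeWeight (chargeWeight (gammaExponent d ℓ) N (t * Real.sqrt d : ℝ) 0) z := by
  have hs : (0 : ℝ) < (N * d : ℕ) := by positivity
  have hd0 : (0 : ℝ) < d := by positivity
  have hcharge (ℓ : ℕ) :
      (fun u : ℂ => ‖u‖ ^ gammaExponent d ℓ * Real.exp (-(N * d : ℕ) * ‖u - t‖ ^ 2)) =
        chargeWeight (gammaExponent d ℓ) (N * d : ℕ) 0 t := by
    simp only [funext_iff, chargeWeight, sub_zero, implies_true]
  have hred := integral_vandermondeWeight_comp_pow (N := N) hd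
    (w := fun u => Real.exp (-(N * d : ℕ) * ‖u - t‖ ^ 2)) (by fun_prop)
    (hasFiniteMoments_exp_neg_mul_norm_pow_sub_sq hs hd t) fun ℓ => by
      simpa only [hcharge] using hasFiniteMoments_chargeWeight (neg_two_lt_gammaExponent hd ℓ) hs
  have hexponent : ∑ ℓ ∈ Finset.range d, (-((N : ℝ) * (N + 1 + gammaExponent d ℓ) / 2)) =
      -((N : ℝ) * (N * d + 2 * d + 1) / 2) + (N * d : ℕ) := by
    rw [Finset.sum_neg_distrib, ← Finset.sum_div, ← Finset.mul_sum, Finset.sum_add_distrib,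
      sum_gammaExponent hd]
    simp
    ring
  simp_rw [partitionFunction, weight_lemniscatePotential, integral_const_mul, hred, hcharge,
    integral_vandermondeWeight_chargeWeight_recenter hd, Finset.prod_mul_distrib,
    ← Real.rpow_sum_of_pos hd0, hexponent, Real.rpow_add hd0, Finset.prod_const, Finset.card_range,
    Real.rpow_natCast, reductionConstant]
  rw [pow_mul, inv_pow, mul_pow ((d : ℝ) ^ N)]
  field_simp

end Reduction

section BorderedMatrix

open Matrix Polynomial

variable {R ι : Type*} [CommRing R]

/-- The matrix with corner `a`, remaining first row `w`, remaining first column `c` and lower right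
block `D`. -/
def bordered (a : R) (w c : ι → R) (D : Matrix ι ι R) : Matrix (Unit ⊕ ι) (Unit ⊕ ι) R :=
  fromBlocks (of fun _ _ => a) (replicateRow Unit w) (replicateCol Unit c) D

lemma bordered_one_zero_zero_one [DecidableEq ι] :
    bordered (1 : R) 0 0 (1 : Matrix ι ι R) = 1 := by
  ext (i | i) (j | j) <;> simp [bordered, one_apply]

variable [Fintype ι]

lemma bordered_mul_bordered (a a' : R) (w w' c c' : ι → R) (D D' : Matrix ι ι R) :
    bordered a w c D * bordered a' w' c' D' =
      bordered (a * a' + w ⬝ᵥ c') (a • w' + w ᵥ* D') (a' • c + D *ᵥ c')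
        (vecMulVec c w' + D * D') := by
  rw [bordered, bordered, fromBlocks_multiply, bordered]
  congr 1 <;> ext i j <;>
    simp [mul_apply, dotProduct, vecMul, mulVec, vecMulVec_apply, mul_comm]

variable [DecidableEq ι]

lemma det_bordered_zero_left (a : R) (w : ι → R) (D : Matrix ι ι R) :
    (bordered a w 0 D).det = a * D.det := by
  rw [bordered, replicateCol_zero, det_fromBlocks_zero₂₁, det_unique, of_apply]

lemma det_bordered_zero_right (a : R) (c : ι → R) (D : Matrix ι ι R) :
    (bordered a 0 c D).det = a * D.det := by
  rw [bordered, replicateRow_zero, det_fromBlocks_zero₁₂, det_unique, of_apply]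

lemma det_bordered [IsDomain R] (a : R) (w c : ι → R) {D : Matrix ι ι R} (hD : D.det ≠ 0) :
    (bordered a w c D).det = a * D.det - w ⬝ᵥ D.adjugate *ᵥ c := by
  have helim : bordered a w c D * bordered D.det 0 (-(D.adjugate *ᵥ c)) 1 =
      bordered (a * D.det - w ⬝ᵥ D.adjugate *ᵥ c) w 0 D := by
    rw [bordered_mul_bordered]
    simp [mulVec_neg, mulVec_mulVec, mul_adjugate, smul_mulVec, sub_eq_add_neg]
  have hdet := congrArg det helim
  rw [det_mul, det_bordered_zero_right, det_one, mul_one, det_bordered_zero_left] at hdet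
  exact mul_right_cancel₀ hD hdet

lemma charmatrix_bordered (a : R) (w c : ι → R) (D : Matrix ι ι R) :
    charmatrix (bordered a w c D) =
      bordered (X - C a) (-(C ∘ w)) (-(C ∘ c)) (charmatrix D) := by
  ext1 (i | i) (j | j) <;> simp [bordered, charmatrix_apply, diagonal_apply]

lemma charpoly_bordered [IsDomain R] (a : R) (w c : ι → R) (D : Matrix ι ι R) :
    (bordered a w c D).charpoly =
      (X - C a) * D.charpoly - (C ∘ w) ⬝ᵥ (charmatrix D).adjugate *ᵥ (C ∘ c) := by
  rw [Matrix.charpoly, charmatrix_bordered, det_bordered _ _ _ (charpoly_monic D).ne_zero]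
  simp [mulVec_neg, Matrix.charpoly]

lemma charpoly_bordered_zero_left (a : R) (w : ι → R) (D : Matrix ι ι R) :
    (bordered a w 0 D).charpoly = (X - C a) * D.charpoly := by
  rw [Matrix.charpoly, charmatrix_bordered]
  have : -(C ∘ (0 : ι → R)) = 0 := by ext; simp
  rw [this, det_bordered_zero_left, Matrix.charpoly]

lemma charpoly_mul_mul_of_mul_eq_one {κ : Type*} [Fintype κ] [DecidableEq κ]
    {L L' : Matrix κ κ R} (h : L * L' = 1) (T : Matrix κ κ R) :
    (L * T * L').charpoly = T.charpoly := by
  rw [charpoly_mul_comm, ← Matrix.mul_assoc, mul_eq_one_comm.1 h, Matrix.one_mul]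

/-- The unipotent matrix whose first column is `(1, q)`. -/
def shear (q : ι → R) : Matrix (Unit ⊕ ι) (Unit ⊕ ι) R := bordered 1 0 q 1

lemma shear_mul_shear_neg (q : ι → R) : shear q * shear (-q) = 1 := by
  rw [shear, shear, bordered_mul_bordered, ← bordered_one_zero_zero_one]
  simp

lemma det_shear (q : ι → R) : (shear q).det = 1 := by
  rw [shear, det_bordered_zero_right, det_one, mul_one]

lemma shear_mul_bordered_mul_shear_neg (x : R) (q w : ι → R) (B : Matrix ι ι R) :
    shear q * bordered x w 0 B * shear (-q) =
      bordered (x - w ⬝ᵥ q) w (x • q - (B + vecMulVec q w) *ᵥ q) (B + vecMulVec q w) := by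
  rw [shear, shear, bordered_mul_bordered, bordered_mul_bordered]
  simp [sub_eq_add_neg, mulVec_neg, add_comm]

end BorderedMatrix

section FrobeniusNorm

open Matrix

/-- The squared Frobenius norm. -/
noncomputable def frobSq {ι κ : Type*} [Fintype ι] [Fintype κ] (A : Matrix ι κ ℂ) : ℝ :=
  ∑ i, ∑ j, ‖A i j‖ ^ 2

variable {ι : Type*} [Fintype ι]

lemma ofReal_frobSq_eq_trace (A : Matrix ι ι ℂ) : (frobSq A : ℂ) = (Aᴴ * A).trace := by
  simp only [frobSq, trace, diag, mul_apply, conjTranspose_apply, Complex.ofReal_sum]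
  rw [Finset.sum_comm]
  refine Finset.sum_congr rfl fun j _ => Finset.sum_congr rfl fun i _ => ?_
  rw [RCLike.star_def, RCLike.conj_mul, Complex.ofReal_pow]
  rfl

lemma frobSq_unitary_conj [DecidableEq ι] {U : Matrix ι ι ℂ} (hU : Uᴴ * U = 1)
    (A : Matrix ι ι ℂ) : frobSq (Uᴴ * A * U) = frobSq A := by
  have hU' : U * Uᴴ = 1 := mul_eq_one_comm.1 hU
  refine Complex.ofReal_injective ?_
  calc ((frobSq (Uᴴ * A * U) : ℝ) : ℂ)
      = (Uᴴ * (Aᴴ * (U * Uᴴ) * A * U)).trace := by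
        rw [ofReal_frobSq_eq_trace, conjTranspose_mul, conjTranspose_mul,
          conjTranspose_conjTranspose]
        simp only [Matrix.mul_assoc]
    _ = (Aᴴ * A * (U * Uᴴ)).trace := by
        rw [hU', trace_mul_comm, Matrix.mul_one, Matrix.mul_assoc, hU']
    _ = frobSq A := by rw [hU', Matrix.mul_one, ofReal_frobSq_eq_trace]

lemma frobSq_bordered (a : ℂ) (w c : ι → ℂ) (D : Matrix ι ι ℂ) :
    frobSq (bordered a w c D) = ‖a‖ ^ 2 + ∑ j, ‖w j‖ ^ 2 + (∑ i, ‖c i‖ ^ 2 + frobSq D) := by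
  simp [frobSq, bordered, Finset.sum_add_distrib, add_add_add_comm]

lemma frobSq_reindex {κ : Type*} [Fintype κ] (e : ι ≃ κ) (A : Matrix ι ι ℂ) :
    frobSq (reindex e e A) = frobSq A := by
  simp only [frobSq, reindex_apply, submatrix_apply]
  rw [e.symm.sum_comp fun i => ∑ j, ‖A i (e.symm j)‖ ^ 2]
  exact Finset.sum_congr rfl fun i _ => e.symm.sum_comp fun j => ‖A i j‖ ^ 2

variable [DecidableEq ι]

lemma exists_unitary_first_column (q : ι → ℂ) :
    ∃ (U : Matrix (Unit ⊕ ι) (Unit ⊕ ι) ℂ) (ρ : ℂ), Uᴴ * U = 1 ∧ ρ ≠ 0 ∧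
      ∀ i, U i (Sum.inl ()) * ρ = Sum.elim (fun _ => 1) q i := by
  set v : EuclideanSpace ℂ (Unit ⊕ ι) := WithLp.toLp 2 (Sum.elim (fun _ => 1) q) with hv
  have hv0 : v ≠ 0 := fun h => by
    simpa [hv] using congrArg (fun u : EuclideanSpace ℂ (Unit ⊕ ι) => u (Sum.inl ())) h
  have hn : ‖v‖ ≠ 0 := norm_ne_zero_iff.2 hv0
  have horth : Orthonormal ℂ (({Sum.inl ()} : Set (Unit ⊕ ι)).domRestrict
      fun _ => ((‖v‖⁻¹ : ℝ) : ℂ) • v) :=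
    ⟨fun i => by simp [norm_smul, hn], fun i j hij => absurd (Subsingleton.elim i j) hij⟩
  obtain ⟨b, hb⟩ := horth.exists_orthonormalBasis_extension_of_card_eq (by simp)
  refine ⟨of fun i j => b j i, ‖v‖, ?_, by exact_mod_cast hn, fun i => ?_⟩
  · ext i j
    rw [one_apply, ← orthonormal_iff_ite.1 b.orthonormal i j, PiLp.inner_apply]
    simp [mul_apply, mul_comm]
  · rw [of_apply, hb (Sum.inl ()) rfl, PiLp.smul_apply, smul_eq_mul, mul_right_comm,
      Complex.ofReal_inv, inv_mul_cancel₀ (by exact_mod_cast hn), one_mul]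

lemma exists_shear_eq_unitary_mul_bordered (q : ι → ℂ) :
    ∃ (U : Matrix (Unit ⊕ ι) (Unit ⊕ ι) ℂ) (ρ : ℂ) (s : ι → ℂ) (S : Matrix ι ι ℂ),
      Uᴴ * U = 1 ∧ ρ ≠ 0 ∧ IsUnit S.det ∧ shear q = U * bordered ρ s 0 S := by
  obtain ⟨U, ρ, hU, hρ, hUρ⟩ := exists_unitary_first_column q
  set R := Uᴴ * shear q with hR_def
  have hcol i : R i (Sum.inl ()) = (1 : Matrix (Unit ⊕ ι) (Unit ⊕ ι) ℂ) i (Sum.inl ()) * ρ := by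
    rw [← hU, hR_def, mul_apply, mul_apply, Finset.sum_mul]
    refine Finset.sum_congr rfl fun k _ => ?_
    rw [mul_assoc, hUρ]
    rcases k with k | k <;> simp [shear, bordered]
  have hR : R = bordered ρ (fun j => R (Sum.inl ()) (Sum.inr j)) 0 R.toBlocks₂₂ := by
    ext (i | i) (j | j)
    · simpa [bordered] using hcol (Sum.inl i)
    · rfl
    · simpa [bordered] using hcol (Sum.inr i)
    · rfl
  have hUR : shear q = U * R := by
    rw [← Matrix.mul_assoc, mul_eq_one_comm.1 hU, Matrix.one_mul]
  have hdetR : IsUnit R.det :=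
    isUnit_of_mul_isUnit_right (x := U.det) (by rw [← det_mul, ← hUR, det_shear]; exact isUnit_one)
  rw [hR, det_bordered_zero_left] at hdetR
  exact ⟨U, ρ, _, _, hU, hρ, isUnit_of_mul_isUnit_right hdetR, hUR.trans (by rw [← hR])⟩

lemma bordered_conj_upper {S : Matrix ι ι ℂ} (hS : IsUnit S.det) (ρ x : ℂ) (s w : ι → ℂ)
    (B : Matrix ι ι ℂ) :
    bordered ρ s 0 S * bordered x w 0 B =
      bordered x ((ρ • w + (s ᵥ* B - x • s)) ᵥ* S⁻¹) 0 (S * B * S⁻¹) * bordered ρ s 0 S := by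
  rw [bordered_mul_bordered, bordered_mul_bordered, vecMul_vecMul, nonsing_inv_mul S hS,
    vecMul_one, Matrix.mul_assoc _ S⁻¹, nonsing_inv_mul S hS, add_left_comm, add_sub_cancel]
  simp [mul_comm]

/-- In a unitary frame adapted to its eigenvector `(1, q)`, the matrix becomes block triangular. -/
lemma exists_frobSq_shear_conj_eq (q : ι → ℂ) :
    ∃ (ρ : ℂ) (s : ι → ℂ) (S : Matrix ι ι ℂ), ρ ≠ 0 ∧ IsUnit S.det ∧
      ∀ (x : ℂ) (w : ι → ℂ) (B : Matrix ι ι ℂ),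
        frobSq (shear q * bordered x w 0 B * shear (-q)) =
          ‖x‖ ^ 2 + ∑ j, ‖((ρ • w + (s ᵥ* B - x • s)) ᵥ* S⁻¹) j‖ ^ 2 + frobSq (S * B * S⁻¹) := by
  obtain ⟨U, ρ, s, S, hU, hρ, hS, hshear⟩ := exists_shear_eq_unitary_mul_bordered q
  refine ⟨ρ, s, S, hρ, hS, fun x w B => ?_⟩
  set R := bordered ρ s 0 S
  set T := bordered x ((ρ • w + (s ᵥ* B - x • s)) ᵥ* S⁻¹) 0 (S * B * S⁻¹)
  have hR : R * shear (-q) * U = 1 := mul_eq_one_comm.1 <| by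
    rw [← Matrix.mul_assoc, ← hshear, shear_mul_shear_neg]
  have hconj : Uᴴ * (shear q * bordered x w 0 B * shear (-q)) * U = T := by
    calc Uᴴ * (shear q * bordered x w 0 B * shear (-q)) * U
        = (Uᴴ * U) * (R * bordered x w 0 B) * (shear (-q) * U) := by
          rw [hshear]; simp only [Matrix.mul_assoc]
      _ = T * (R * shear (-q) * U) := by
          rw [hU, Matrix.one_mul, bordered_conj_upper hS]; simp only [T, R, Matrix.mul_assoc]
      _ = T := by rw [hR, Matrix.mul_one]
  rw [← frobSq_unitary_conj hU, hconj, frobSq_bordered]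
  simp

end FrobeniusNorm

section NonderogatoryMatrix

open Matrix Polynomial

variable {ι : Type*} [Fintype ι] [DecidableEq ι]

/-- A complex matrix is nonderogatory if every eigenvalue has geometric multiplicity one; this is
expressed by the adjugate of `μ - D` not vanishing at the eigenvalues `μ`. -/
def IsNonderogatory (D : Matrix ι ι ℂ) : Prop :=
  ∀ μ, D.charpoly.IsRoot μ → (scalar ι μ - D).adjugate ≠ 0

lemma eval_adjugate_charmatrix (D : Matrix ι ι ℂ) (μ : ℂ) :
    (charmatrix D).adjugate.map (eval μ) = (scalar ι μ - D).adjugate := by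
  have hmap : (evalRingHom μ).mapMatrix (charmatrix D) = scalar ι μ - D := by
    ext i j
    by_cases hij : i = j <;> simp [hij]
  rw [← hmap, ← RingHom.map_adjugate]
  rfl

lemma isNonderogatory_of_separable {D : Matrix ι ι ℂ} (hD : D.charpoly.Separable) :
    IsNonderogatory D := by
  intro μ hμ hadj
  have hdvd i j : X - C μ ∣ (charmatrix D).adjugate i j :=
    dvd_iff_isRoot.2 <| by
      rw [IsRoot, ← map_apply (f := eval μ) (M := (charmatrix D).adjugate),
        eval_adjugate_charmatrix, hadj, Matrix.zero_apply]
  choose K hK using hdvd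
  obtain ⟨P, hP⟩ := dvd_iff_isRoot.2 hμ
  have hcancel : charmatrix D * of K = P • 1 := by
    have hmul : (X - C μ) • (charmatrix D * of K) = (X - C μ) • (P • 1) := by
      rw [← Matrix.mul_smul, smul_smul, ← hP, Matrix.charpoly, ← mul_adjugate]
      congr 1
      ext1 i j
      rw [hK, Matrix.smul_apply, of_apply, smul_eq_mul]
    exact smul_right_injective _ (X_sub_C_ne_zero μ) hmul
  have hroot : P.IsRoot μ := by
    have hdet := congrArg (fun M => eval μ (det M)) hcancel
    simp only [det_mul, det_smul, det_one, eval_mul, eval_pow, mul_one] at hdet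
    exact eq_zero_of_pow_eq_zero (hdet.symm.trans (by rw [← Matrix.charpoly, hμ.eq_zero, zero_mul]))
  refine not_isUnit_X_sub_C μ (hD.squarefree (X - C μ) ?_)
  rw [hP]
  exact mul_dvd_mul_left _ (dvd_iff_isRoot.2 hroot)

lemma continuous_scalar_sub : Continuous fun p : Matrix ι ι ℂ × ℂ => scalar ι p.2 - p.1 := by
  simp only [scalar_apply]
  fun_prop

lemma continuous_eval_charpoly :
    Continuous fun p : Matrix ι ι ℂ × ℂ => p.1.charpoly.eval p.2 := by
  simp only [eval_charpoly]
  exact continuous_scalar_sub.matrix_det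

lemma measurableSet_exists_of_isClosed {X Y : Type*} [TopologicalSpace X] [MeasurableSpace X]
    [BorelSpace X] [TopologicalSpace Y] [SigmaCompactSpace Y] {S : Set (X × Y)}
    (hS : IsClosed S) : MeasurableSet {x | ∃ y, (x, y) ∈ S} := by
  have hunion : {x | ∃ y, (x, y) ∈ S} = ⋃ k : ℕ, Prod.fst ''
      ((fun p : X × compactCovering Y k => (p.1, (p.2 : Y))) ⁻¹' S) := by
    ext x
    simp only [Set.mem_ofPred_eq, Set.mem_iUnion, Set.mem_image, Set.mem_preimage, Prod.exists,
      exists_and_right, exists_eq_right]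
    refine ⟨fun ⟨y, hy⟩ => ?_, fun ⟨_, y, hy⟩ => ⟨y, hy⟩⟩
    obtain ⟨k, hk⟩ := exists_mem_compactCovering y
    exact ⟨k, ⟨y, hk⟩, hy⟩
  rw [hunion]
  refine .iUnion fun k => ?_
  have : CompactSpace (compactCovering Y k) :=
    isCompact_iff_compactSpace.1 (isCompact_compactCovering Y k)
  exact (isClosedMap_fst_of_compactSpace _ (hS.preimage (by fun_prop))).measurableSet

lemma measurableSet_isNonderogatory :
    MeasurableSet {D : ι → ι → ℂ | IsNonderogatory (of D)} := by
  have hclosed : IsClosed {p : (ι → ι → ℂ) × ℂ |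
      (of p.1).charpoly.eval p.2 = 0 ∧ (scalar ι p.2 - of p.1).adjugate = 0} :=
    (isClosed_eq continuous_eval_charpoly continuous_const).inter
      (isClosed_eq continuous_scalar_sub.matrix_adjugate continuous_const)
  convert! (measurableSet_exists_of_isClosed hclosed).compl using 1
  ext D
  simp [IsNonderogatory, IsRoot]

omit [DecidableEq ι] in
lemma ae_linearMap_ne_zero {M : Type*} [AddCommGroup M] [Module ℂ M] {f : (ι → ℂ) →ₗ[ℂ] M}
    (hf : f ≠ 0) : ∀ᵐ v : ι → ℂ, f v ≠ 0 := by
  have hker : (volume : Measure (ι → ℂ)) ((LinearMap.ker f).restrictScalars ℝ : Submodule ℝ _) =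
      0 := by
    refine Measure.addHaar_submodule volume _ fun htop => hf ?_
    rw [Submodule.restrictScalars_eq_top_iff] at htop
    exact LinearMap.ker_eq_top.1 htop
  rw [ae_iff]
  simp only [not_not]
  exact hker

lemma eval_charpoly_bordered (μ a : ℂ) (w c : ι → ℂ) (D : Matrix ι ι ℂ) :
    (bordered a w c D).charpoly.eval μ =
      (μ - a) * D.charpoly.eval μ - (w ᵥ* (scalar ι μ - D).adjugate) ⬝ᵥ c := by
  rw [charpoly_bordered, ← eval_adjugate_charmatrix, ← dotProduct_mulVec]
  simp [dotProduct, mulVec, eval_finsetSum]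

theorem ae_isCoprime_charpoly_bordered {D : Matrix ι ι ℂ} (hD : IsNonderogatory D) :
    ∀ᵐ w : ι → ℂ, ∀ᵐ c : ι → ℂ, IsCoprime (bordered 0 w c D).charpoly D.charpoly := by
  have hmem μ : μ ∈ D.charpoly.roots.toFinset ↔ D.charpoly.IsRoot μ := by
    rw [Multiset.mem_toFinset, mem_roots (charpoly_monic D).ne_zero]
  have hw : ∀ᵐ w : ι → ℂ, ∀ μ ∈ D.charpoly.roots.toFinset,
      w ᵥ* (scalar ι μ - D).adjugate ≠ 0 := by
    refine (Filter.eventually_all_finset _).2 fun μ hμ => ?_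
    refine ae_linearMap_ne_zero (f := vecMulLinear _) fun h => hD μ ((hmem μ).1 hμ) ?_
    ext i j
    simpa using congrFun (LinearMap.congr_fun h (Pi.single i 1)) j
  filter_upwards [hw] with w hw
  have hc : ∀ᵐ c : ι → ℂ, ∀ μ ∈ D.charpoly.roots.toFinset,
      (w ᵥ* (scalar ι μ - D).adjugate) ⬝ᵥ c ≠ 0 := by
    refine (Filter.eventually_all_finset _).2 fun μ hμ => ?_
    refine ae_linearMap_ne_zero (f := dotProductBilin ℂ ℂ _) fun h => hw μ hμ ?_
    ext i
    simpa using LinearMap.congr_fun h (Pi.single i 1)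
  filter_upwards [hc] with c hc
  rw [isCoprime_iff_aeval_ne_zero_of_isAlgClosed ℂ ℂ]
  intro μ
  simp only [coe_aeval_eq_eval]
  by_cases hμ : D.charpoly.eval μ = 0
  · left
    rw [eval_charpoly_bordered, hμ, mul_zero, zero_sub, neg_ne_zero]
    exact hc μ ((hmem μ).2 hμ)
  · exact Or.inr hμ

end NonderogatoryMatrix

section BlockMeasure

open Matrix
open scoped ENNReal

variable {n : ℕ}

/-- The array with first row `(a, w)`, first column `(a, c)` and remaining block `D`: the version
of `bordered` on `Fin (n + 1)`, for which the entries are integrated against Lebesgue measure. -/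
def blk (a : ℂ) (w c : Fin n → ℂ) (D : Fin n → Fin n → ℂ) : Fin (n + 1) → Fin (n + 1) → ℂ :=
  Fin.cons (Fin.cons a w) fun i => Fin.cons (c i) (D i)

/-- The splitting of the index set `Fin (n + 1)` into its first element and the others. -/
def unitSumFinEquiv (n : ℕ) : Unit ⊕ Fin n ≃ Fin (n + 1) where
  toFun := Sum.elim (fun _ => 0) Fin.succ
  invFun := Fin.cases (Sum.inl ()) Sum.inr
  left_inv := by rintro (_ | _) <;> rfl
  right_inv i := Fin.cases rfl (fun _ => rfl) i

lemma of_blk (a : ℂ) (w c : Fin n → ℂ) (D : Fin n → Fin n → ℂ) :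
    of (blk a w c D) =
      reindex (unitSumFinEquiv n) (unitSumFinEquiv n) (bordered a w c (of D)) := by
  rw [← Equiv.symm_apply_eq]
  ext (i | i) (j | j) <;> rfl

lemma charpoly_blk (a : ℂ) (w c : Fin n → ℂ) (D : Fin n → Fin n → ℂ) :
    (of (blk a w c D)).charpoly = (bordered a w c (of D)).charpoly := by
  rw [of_blk, charpoly_reindex]

lemma charpoly_blk_eq_sub (a : ℂ) (w c : Fin n → ℂ) (D : Fin n → Fin n → ℂ) :
    (of (blk a w c D)).charpoly =
      (of (blk 0 w c D)).charpoly - Polynomial.C a * (of D).charpoly := by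
  rw [charpoly_blk, charpoly_blk, charpoly_bordered, charpoly_bordered, Polynomial.C_0]
  ring

lemma degree_charpoly_lt_degree_charpoly_blk (a : ℂ) (w c : Fin n → ℂ) (D : Fin n → Fin n → ℂ) :
    (of D).charpoly.degree < (of (blk a w c D)).charpoly.degree := by
  simp only [charpoly_degree_eq_dim, Fintype.card_fin]
  exact_mod_cast n.lt_succ_self

lemma natDegree_charpoly_blk (a : ℂ) (w c : Fin n → ℂ) (D : Fin n → Fin n → ℂ) :
    (of (blk a w c D)).charpoly.natDegree = n + 1 := by
  rw [charpoly_natDegree_eq_dim, Fintype.card_fin]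

@[fun_prop]
lemma measurable_blk {α : Type*} [MeasurableSpace α] {a : α → ℂ} {w c : α → Fin n → ℂ}
    {D : α → Fin n → Fin n → ℂ} (ha : Measurable a) (hw : Measurable w) (hc : Measurable c)
    (hD : Measurable D) : Measurable fun p => blk (a p) (w p) (c p) (D p) := by
  refine measurable_pi_iff.2 fun i => measurable_pi_iff.2 fun j => ?_
  refine Fin.cases ?_ (fun i => ?_) i <;> refine Fin.cases ?_ (fun j => ?_) j <;>
    simp only [blk, Fin.cons_zero, Fin.cons_succ] <;> fun_prop

lemma measurePreserving_cons (X : Type*) [MeasureSpace X] [SigmaFinite (volume : Measure X)] :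
    MeasurePreserving (fun p : X × (Fin n → X) => (Fin.cons p.1 p.2 : Fin (n + 1) → X)) := by
  convert! (volume_preserving_piFinSuccAbove (fun _ : Fin (n + 1) => X) 0).symm using 1
  ext p
  simp [MeasurableEquiv.piFinSuccAbove, Fin.insertNthEquiv]

lemma measurePreserving_blk : MeasurePreserving
    fun p : (ℂ × (Fin n → ℂ)) × (Fin n → ℂ) × (Fin n → Fin n → ℂ) =>
      blk p.1.1 p.1.2 p.2.1 p.2.2 := by
  have hrows : MeasurePreserving fun p : (Fin n → ℂ) × (Fin n → Fin n → ℂ) =>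
      fun i => (Fin.cons (p.1 i) (p.2 i) : Fin (n + 1) → ℂ) :=
    (volume_preserving_pi fun _ : Fin n => measurePreserving_cons (n := n) ℂ).comp
      (volume_measurePreserving_arrowProdEquivProdArrow ℂ (Fin n → ℂ) (Fin n)).symm
  exact (measurePreserving_cons (n := n) (Fin (n + 1) → ℂ)).comp
    ((measurePreserving_cons (n := n) ℂ).prod hrows)

theorem lintegral_blk {F : (Fin (n + 1) → Fin (n + 1) → ℂ) → ℝ≥0∞} (hF : Measurable F) :
    ∫⁻ A, F A = ∫⁻ D : Fin n → Fin n → ℂ, ∫⁻ w : Fin n → ℂ, ∫⁻ c : Fin n → ℂ, ∫⁻ a : ℂ,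
      F (blk a w c D) := by
  rw [← measurePreserving_blk.lintegral_comp hF]
  refine (lintegral_prod_symm _ (by fun_prop)).trans ?_
  refine (lintegral_prod_symm _ (by fun_prop)).trans <| lintegral_congr fun D => ?_
  refine (lintegral_lintegral_swap
    (f := fun c (p : ℂ × (Fin n → ℂ)) => F (blk p.1 p.2 c D)) (by fun_prop)).trans ?_
  refine (lintegral_prod_symm _ (by fun_prop)).trans <| lintegral_congr fun w => ?_
  exact lintegral_lintegral_swap (f := fun a c => F (blk a w c D)) (by fun_prop)

theorem ae_isNonderogatory (n : ℕ) : ∀ᵐ D : Fin n → Fin n → ℂ, IsNonderogatory (of D) := by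
  induction n with
  | zero => exact ae_of_all _ fun D => isNonderogatory_of_separable (by simp [charpoly])
  | succ n ih =>
    set bad := {A : Fin (n + 1) → Fin (n + 1) → ℂ | ¬ IsNonderogatory (of A)}
    have hbad : MeasurableSet bad := measurableSet_isNonderogatory.compl
    rw [ae_iff, ← lintegral_indicator_one hbad, lintegral_blk (measurable_one.indicator hbad)]
    refine (lintegral_congr_ae ?_).trans lintegral_zero
    filter_upwards [ih] with D hD
    refine (lintegral_congr_ae ?_).trans lintegral_zero
    filter_upwards [ae_isCoprime_charpoly_bordered hD] with w hw
    refine (lintegral_congr_ae ?_).trans lintegral_zero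
    filter_upwards [hw] with c hc
    refine (lintegral_congr_ae ?_).trans lintegral_zero
    rw [← charpoly_blk] at hc
    filter_upwards [ae_separable_sub_C_mul hc (by rw [natDegree_charpoly_blk]; omega)] with a ha
    rw [← charpoly_blk_eq_sub] at ha
    exact Set.indicator_of_notMem (not_not.2 (isNonderogatory_of_separable ha)) _

end BlockMeasure

section ChangeOfVariables

open Matrix Polynomial
open scoped ENNReal

lemma eval_wronskian_of_eq {R : Type*} [CommRing R] {P Q S : R[X]} {a x : R}
    (hP : P = C a * Q + (X - C x) * S) : (wronskian Q P).eval x = Q.eval x * S.eval x := by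
  simp only [wronskian, hP, derivative_add, derivative_mul, derivative_C, derivative_sub,
    derivative_X, eval_add, eval_sub, eval_mul, eval_C, eval_X, eval_zero, eval_one]
  ring

lemma lintegral_comp_linearMap {E : Type*} [NormedAddCommGroup E] [NormedSpace ℝ E]
    [MeasurableSpace E] [BorelSpace E] [FiniteDimensional ℝ E] (μ : Measure E)
    [μ.IsAddHaarMeasure] {f : E →ₗ[ℝ] E} (hf : LinearMap.det f ≠ 0) {h : E → ℝ≥0∞}
    (hh : Measurable h) :
    ∫⁻ v, h (f v) ∂μ = ENNReal.ofReal |(LinearMap.det f)⁻¹| * ∫⁻ v, h v ∂μ := by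
  rw [← lintegral_map hh f.continuous_of_finiteDimensional.measurable,
    Measure.map_linearMap_addHaar_eq_smul_addHaar μ hf, lintegral_smul_measure, smul_eq_mul]

lemma lintegral_mulVec {ι : Type*} [Fintype ι] [DecidableEq ι] {M : Matrix ι ι ℂ}
    (hM : M.det ≠ 0) {h : (ι → ℂ) → ℝ≥0∞} (hh : Measurable h) :
    ∫⁻ c, h c = ‖M.det‖ₑ ^ 2 * ∫⁻ q, h (M *ᵥ q) := by
  have habs := ofReal_abs_det_restrictScalars (toLin' M)
  rw [LinearMap.det_toLin'] at habs
  have hdet : LinearMap.det ((toLin' M).restrictScalars ℝ) ≠ 0 := fun h0 => hM <| by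
    simpa [h0] using habs.symm
  calc ∫⁻ c, h c
      = ‖M.det‖ₑ ^ 2 * (ENNReal.ofReal |(LinearMap.det ((toLin' M).restrictScalars ℝ))⁻¹| *
          ∫⁻ c, h c) := by
        rw [← habs, ← mul_assoc, ← ENNReal.ofReal_mul (abs_nonneg _), ← abs_mul,
          mul_inv_cancel₀ hdet, abs_one, ENNReal.ofReal_one, one_mul]
    _ = ‖M.det‖ₑ ^ 2 * ∫⁻ q, h (M *ᵥ q) := by
        rw [← lintegral_comp_linearMap volume hdet hh]
        rfl

lemma lintegral_four_swap {A B C E : Type*} [MeasureSpace A] [MeasureSpace B] [MeasureSpace C]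
    [MeasureSpace E] [SigmaFinite (volume : Measure A)] [SigmaFinite (volume : Measure B)]
    [SigmaFinite (volume : Measure C)] [SigmaFinite (volume : Measure E)]
    {f : A → B → C → E → ℝ≥0∞}
    (hf : Measurable fun p : (A × B) × C × E => f p.1.1 p.1.2 p.2.1 p.2.2) :
    ∫⁻ a, ∫⁻ b, ∫⁻ c, ∫⁻ e, f a b c e = ∫⁻ c, ∫⁻ e, ∫⁻ b, ∫⁻ a, f a b c e := by
  have hce a b : ∫⁻ c, ∫⁻ e, f a b c e = ∫⁻ q : C × E, f a b q.1 q.2 :=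
    (lintegral_prod (fun q : C × E => f a b q.1 q.2)
      (hf.comp (measurable_prodMk_left (x := (a, b)))).aemeasurable).symm
  have hba c e : ∫⁻ b, ∫⁻ a, f a b c e = ∫⁻ p : A × B, f p.1 p.2 c e :=
    (lintegral_prod_symm (fun p : A × B => f p.1 p.2 c e)
      (hf.comp (measurable_prodMk_right (y := (c, e)))).aemeasurable).symm
  simp_rw [hce, hba]
  rw [← lintegral_prod (fun p : A × B => ∫⁻ q : C × E, f p.1 p.2 q.1 q.2)
    hf.lintegral_prod_right'.aemeasurable,
    ← lintegral_prod (fun q : C × E => ∫⁻ p : A × B, f p.1 p.2 q.1 q.2)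
    hf.lintegral_prod_left'.aemeasurable]
  exact lintegral_lintegral_swap hf.aemeasurable

variable {n : ℕ}

/-- The array with eigenvalue `x` and eigenvector `(1, q)`, first row `w` off the diagonal and lower
right block `D`. -/
noncomputable def eigenBlk (x : ℂ) (q w : Fin n → ℂ) (D : Fin n → Fin n → ℂ) :
    Fin (n + 1) → Fin (n + 1) → ℂ :=
  blk (x - w ⬝ᵥ q) w ((scalar (Fin n) x - of D) *ᵥ q) D

lemma of_eigenBlk (x : ℂ) (q w : Fin n → ℂ) (B : Fin n → Fin n → ℂ) :
    of (eigenBlk x q w (B + fun i j => q i * w j)) =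
      reindex (unitSumFinEquiv n) (unitSumFinEquiv n)
        (shear q * bordered x w 0 (of B) * shear (-q)) := by
  rw [eigenBlk, of_blk, shear_mul_bordered_mul_shear_neg, sub_mulVec, scalar_apply,
    ← smul_one_eq_diagonal, smul_mulVec, one_mulVec]
  rfl

lemma charpoly_eigenBlk (x : ℂ) (q w : Fin n → ℂ) (B : Fin n → Fin n → ℂ) :
    (of (eigenBlk x q w (B + fun i j => q i * w j))).charpoly = (X - C x) * (of B).charpoly := by
  rw [of_eigenBlk, charpoly_reindex, charpoly_mul_mul_of_mul_eq_one (shear_mul_shear_neg q),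
    charpoly_bordered_zero_left]

lemma charpoly_blk_zero_mulVec (x : ℂ) (q w : Fin n → ℂ) (D : Fin n → Fin n → ℂ) :
    (of (blk 0 w ((scalar (Fin n) x - of D) *ᵥ q) D)).charpoly =
      C (x - w ⬝ᵥ q) * (of D).charpoly +
        (X - C x) * (of (D - fun i j => q i * w j)).charpoly := by
  rw [← charpoly_eigenBlk x q w, sub_add_cancel, eigenBlk, charpoly_blk_eq_sub (x - w ⬝ᵥ q),
    add_sub_cancel]

@[fun_prop]
lemma measurable_eval_charpoly {α : Type*} [MeasurableSpace α] {D : α → Fin n → Fin n → ℂ}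
    {x : α → ℂ} (hD : Measurable D) (hx : Measurable x) :
    Measurable fun p => (of (D p)).charpoly.eval (x p) := by
  have hcont : Continuous fun p : (Fin n → Fin n → ℂ) × ℂ => (of p.1).charpoly.eval p.2 :=
    continuous_eval_charpoly
  exact hcont.measurable.comp (hD.prodMk hx)

@[fun_prop]
lemma measurable_eigenBlk {α : Type*} [MeasurableSpace α] {x : α → ℂ} {q w : α → Fin n → ℂ}
    {D : α → Fin n → Fin n → ℂ} (hx : Measurable x) (hq : Measurable q) (hw : Measurable w)
    (hD : Measurable D) : Measurable fun p => eigenBlk (x p) (q p) (w p) (D p) := by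
  simp only [eigenBlk, dotProduct, sub_mulVec, scalar_apply, ← smul_one_eq_diagonal, smul_mulVec,
    one_mulVec]
  refine measurable_blk (by fun_prop) hw ((hx.smul hq).sub (measurable_pi_iff.2 fun i => ?_)) hD
  simp only [mulVec, dotProduct, of_apply]
  fun_prop

@[fun_prop]
lemma measurable_eval_wronskian_blk {α : Type*} [MeasurableSpace α] (w : Fin n → ℂ)
    (D : Fin n → Fin n → ℂ) {c : α → Fin n → ℂ} {x : α → ℂ} (hc : Measurable c)
    (hx : Measurable x) : Measurable fun p =>
      (wronskian (of D).charpoly (of (blk 0 w (c p) D)).charpoly).eval (x p) := by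
  have hcont : Continuous
      (Function.uncurry fun c x => (bordered 0 w c (of D)).charpoly.eval x) :=
    continuous_eval_charpoly.comp <| (Continuous.matrix_fromBlocks continuous_const
      continuous_const continuous_fst.matrix_replicateCol continuous_const).prodMk continuous_snd
  have hderiv := (measurable_deriv_with_param hcont).comp (hc.prodMk hx)
  simp only [Function.comp_def, Polynomial.deriv] at hderiv
  simp only [wronskian, eval_sub, eval_mul, charpoly_blk]
  exact ((measurable_eval_charpoly measurable_const hx).mul hderiv).sub
    (((of D).charpoly.derivative.continuous.measurable.comp hx).mul
      (hcont.measurable.comp (hc.prodMk hx)))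

lemma lintegral_blk_corner {w c : Fin n → ℂ} {D : Fin n → Fin n → ℂ}
    (hcop : IsCoprime (bordered 0 w c (of D)).charpoly (of D).charpoly)
    {F : (Fin (n + 1) → Fin (n + 1) → ℂ) → ℝ≥0∞} (hF : Measurable F) :
    ((n + 1 : ℕ) : ℝ≥0∞) * ∫⁻ a, F (blk a w c D) =
      ∫⁻ x, ‖(wronskian (of D).charpoly (of (blk 0 w c D)).charpoly).eval x /
          (of D).charpoly.eval x ^ 2‖ₑ ^ 2 *
        F (blk ((of (blk 0 w c D)).charpoly.eval x / (of D).charpoly.eval x) w c D) := by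
  rw [← charpoly_blk] at hcop
  rw [lintegral_enorm_deriv_div_sq_mul (h := fun a => F (blk a w c D)) (charpoly_monic _)
    (by rw [natDegree_charpoly_blk]; omega) (degree_charpoly_lt_degree_charpoly_blk 0 w c D)
    (charpoly_monic _).ne_zero hcop (by fun_prop), natDegree_charpoly_blk]

lemma lintegral_wronskian_blk (w : Fin n → ℂ) (D : Fin n → Fin n → ℂ) {x : ℂ}
    (hx : (of D).charpoly.eval x ≠ 0) {F : (Fin (n + 1) → Fin (n + 1) → ℂ) → ℝ≥0∞}
    (hF : Measurable F) :
    ∫⁻ c : Fin n → ℂ, ‖(wronskian (of D).charpoly (of (blk 0 w c D)).charpoly).eval x /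
          (of D).charpoly.eval x ^ 2‖ₑ ^ 2 *
        F (blk ((of (blk 0 w c D)).charpoly.eval x / (of D).charpoly.eval x) w c D) =
      ∫⁻ q : Fin n → ℂ, ‖(of (D - fun i j => q i * w j)).charpoly.eval x‖ₑ ^ 2 *
        F (eigenBlk x q w D) := by
  have hdet : (scalar (Fin n) x - of D).det ≠ 0 := by rwa [← eval_charpoly]
  rw [lintegral_mulVec hdet, ← lintegral_const_mul']
  · refine lintegral_congr fun q => ?_
    have hP := charpoly_blk_zero_mulVec x q w D
    have hcorner := congrArg (eval x) hP
    simp only [eval_add, eval_mul, eval_C, eval_sub, eval_X, sub_self, zero_mul, add_zero]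
      at hcorner
    rw [eval_wronskian_of_eq hP, hcorner, mul_div_cancel_right₀ _ hx, ← mul_assoc, ← mul_pow,
      ← enorm_mul, ← eval_charpoly, sq (eval x (of D).charpoly), mul_div_mul_left _ _ hx,
      mul_div_cancel₀ _ hx, eigenBlk]
  · exact ENNReal.pow_ne_top enorm_ne_top
  · fun_prop

lemma ae_lintegral_corner {F : (Fin (n + 1) → Fin (n + 1) → ℂ) → ℝ≥0∞} (hF : Measurable F) :
    ∀ᵐ D : Fin n → Fin n → ℂ, ∀ᵐ w : Fin n → ℂ,
      ((n + 1 : ℕ) : ℝ≥0∞) * ∫⁻ c : Fin n → ℂ, ∫⁻ a : ℂ, F (blk a w c D) =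
        ∫⁻ x, ∫⁻ q : Fin n → ℂ, ‖(of (D - fun i j => q i * w j)).charpoly.eval x‖ₑ ^ 2 *
          F (eigenBlk x q w D) := by
  filter_upwards [ae_isNonderogatory n] with D hD
  filter_upwards [ae_isCoprime_charpoly_bordered hD] with w hw
  rw [← lintegral_const_mul' _ _ (ENNReal.natCast_ne_top _),
    lintegral_congr_ae (hw.mono fun c hc => lintegral_blk_corner hc hF),
    lintegral_lintegral_swap (by fun_prop)]
  have hroots : {x | (of D).charpoly.IsRoot x}.Finite :=
    finite_setOfPred_isRoot (charpoly_monic _).ne_zero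
  refine lintegral_congr_ae ?_
  filter_upwards [compl_mem_ae_iff.2 (hroots.measure_zero volume)] with x hx
  exact lintegral_wronskian_blk w D hx hF

/-- Every array is counted once for each of its `n + 1` eigenvalues. -/
theorem lintegral_eigenBlk {F : (Fin (n + 1) → Fin (n + 1) → ℂ) → ℝ≥0∞} (hF : Measurable F) :
    ((n + 1 : ℕ) : ℝ≥0∞) * ∫⁻ A, F A =
      ∫⁻ x : ℂ, ∫⁻ q : Fin n → ℂ, ∫⁻ w : Fin n → ℂ, ∫⁻ B : Fin n → Fin n → ℂ,
        ‖(of B).charpoly.eval x‖ₑ ^ 2 * F (eigenBlk x q w (B + fun i j => q i * w j)) := by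
  calc ((n + 1 : ℕ) : ℝ≥0∞) * ∫⁻ A, F A
      = ∫⁻ D : Fin n → Fin n → ℂ, ∫⁻ w : Fin n → ℂ,
          ((n + 1 : ℕ) : ℝ≥0∞) * ∫⁻ c : Fin n → ℂ, ∫⁻ a : ℂ, F (blk a w c D) := by
        simp only [lintegral_blk hF, lintegral_const_mul' _ _ (ENNReal.natCast_ne_top _)]
    _ = ∫⁻ D : Fin n → Fin n → ℂ, ∫⁻ w : Fin n → ℂ, ∫⁻ x, ∫⁻ q : Fin n → ℂ,
          ‖(of (D - fun i j => q i * w j)).charpoly.eval x‖ₑ ^ 2 * F (eigenBlk x q w D) :=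
        lintegral_congr_ae ((ae_lintegral_corner hF).mono fun D hD => lintegral_congr_ae hD)
    _ = ∫⁻ x, ∫⁻ q : Fin n → ℂ, ∫⁻ w : Fin n → ℂ, ∫⁻ D : Fin n → Fin n → ℂ,
          ‖(of (D - fun i j => q i * w j)).charpoly.eval x‖ₑ ^ 2 * F (eigenBlk x q w D) :=
        lintegral_four_swap (by fun_prop)
    _ = _ := by
        refine lintegral_congr fun x => lintegral_congr fun q => lintegral_congr fun w => ?_
        rw [← lintegral_add_right_eq_self _ fun i j => q i * w j]
        simp only [add_sub_cancel_right]

end ChangeOfVariables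

section GaussianDensity

open Matrix
open scoped ENNReal

variable {n : ℕ}

/-- The unnormalised density `exp (-‖A‖²)` of the complex Ginibre ensemble. -/
noncomputable def gaussDensity (A : Fin n → Fin n → ℂ) : ℝ≥0∞ :=
  ENNReal.ofReal (Real.exp (-frobSq (of A)))

lemma exp_neg_frobSq {ι κ : Type*} [Fintype ι] [Fintype κ] (A : Matrix ι κ ℂ) :
    Real.exp (-frobSq A) = ∏ i, ∏ j, Real.exp (-‖A i j‖ ^ 2) := by
  simp only [frobSq, ← Real.exp_sum, ← Finset.sum_neg_distrib]

@[fun_prop]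
lemma measurable_gaussDensity : Measurable (gaussDensity (n := n)) := by
  unfold gaussDensity frobSq
  simp only [of_apply]
  fun_prop

lemma integrable_exp_neg_norm_sq : Integrable fun z : ℂ => Real.exp (-‖z‖ ^ 2) := by
  simpa using integrable_norm_rpow_mul_exp (p := 2) (q := 0) (b := 1) (by norm_num) (by norm_num)
    one_pos

lemma lintegral_gaussDensity_ne_top : ∫⁻ A, gaussDensity (n := n) A ≠ ∞ := by
  have h : Integrable fun A : Fin n → Fin n → ℂ => ∏ i, ∏ j, Real.exp (-‖A i j‖ ^ 2) :=
    Integrable.fintype_prod (f := fun _ (v : Fin n → ℂ) => ∏ j, Real.exp (-‖v j‖ ^ 2)) fun _ =>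
      Integrable.fintype_prod (f := fun _ (z : ℂ) => Real.exp (-‖z‖ ^ 2)) fun _ =>
        integrable_exp_neg_norm_sq
  simpa only [gaussDensity, exp_neg_frobSq, of_apply] using h.lintegral_lt_top.ne

instance isAddHaarMeasure_volume_matrix :
    (volume : Measure (Fin n → Fin n → ℂ)).IsAddHaarMeasure :=
  Measure.pi.isAddHaarMeasure fun _ : Fin n => (volume : Measure (Fin n → ℂ))

lemma lintegral_gaussDensity_ne_zero : ∫⁻ A, gaussDensity (n := n) A ≠ 0 := by
  rw [Ne, lintegral_eq_zero_iff measurable_gaussDensity]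
  intro h
  obtain ⟨A, hA⟩ := (h : ∀ᵐ A : Fin n → Fin n → ℂ, gaussDensity A = 0).exists
  exact (ENNReal.ofReal_pos.2 (Real.exp_pos _)).ne' hA

lemma exists_gaussDensity_eigenBlk_eq (q : Fin n → ℂ) :
    ∃ (M S : Matrix (Fin n) (Fin n) ℂ) (b : ℂ → (Fin n → Fin n → ℂ) → Fin n → ℂ),
      M.det ≠ 0 ∧ IsUnit S.det ∧ ∀ x w B,
        gaussDensity (eigenBlk x q w (B + fun i j => q i * w j)) =
          ENNReal.ofReal (Real.exp (-‖x‖ ^ 2)) *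
            ENNReal.ofReal (Real.exp (-∑ j, ‖(M *ᵥ w + b x B) j‖ ^ 2)) *
            gaussDensity (of.symm (S * of B * S⁻¹)) := by
  obtain ⟨ρ, s, S, hρ, hS, hfrob⟩ := exists_frobSq_shear_conj_eq q
  have hdet : (ρ • (S⁻¹)ᵀ).det ≠ 0 := by
    rw [det_smul, det_transpose]
    exact mul_ne_zero (pow_ne_zero _ hρ) (isUnit_nonsing_inv_det S hS).ne_zero
  refine ⟨ρ • (S⁻¹)ᵀ, S, fun x B => (s ᵥ* of B - x • s) ᵥ* S⁻¹, hdet, hS, fun x w B => ?_⟩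
  rw [gaussDensity, of_eigenBlk, frobSq_reindex, hfrob, neg_add, neg_add, Real.exp_add,
    Real.exp_add, ENNReal.ofReal_mul (by positivity), ENNReal.ofReal_mul (by positivity),
    smul_mulVec, mulVec_transpose, ← smul_vecMul, ← add_vecMul]
  rfl

end GaussianDensity

section EigenvectorFibre

open Matrix
open scoped ENNReal

variable {n : ℕ}

lemma lintegral_comp_mulVec_add {ι : Type*} [Fintype ι] [DecidableEq ι] {M : Matrix ι ι ℂ}
    (hM : M.det ≠ 0) (b : ι → ℂ) {h : (ι → ℂ) → ℝ≥0∞} (hh : Measurable h) :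
    ∫⁻ w, h (M *ᵥ w + b) = (‖M.det‖ₑ ^ 2)⁻¹ * ∫⁻ v, h v := by
  have hchange := lintegral_mulVec hM (h := fun v => h (v + b)) (by fun_prop)
  rw [lintegral_add_right_eq_self h b] at hchange
  rw [hchange, ← mul_assoc, ENNReal.inv_mul_cancel (by simpa using hM)
    (ENNReal.pow_ne_top enorm_ne_top), one_mul]

lemma exists_lintegral_comp_conj {S : Matrix (Fin n) (Fin n) ℂ} (hS : IsUnit S.det) :
    ∃ k : ℝ≥0∞, ∀ h : (Fin n → Fin n → ℂ) → ℝ≥0∞, Measurable h →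
      ∫⁻ B, h (of.symm (S * of B * S⁻¹)) = k * ∫⁻ B, h B := by
  let f : (Fin n → Fin n → ℂ) →ₗ[ℝ] (Fin n → Fin n → ℂ) :=
    (LinearMap.mulLeftRight ℂ (S, S⁻¹)).restrictScalars ℝ
  have hker : LinearMap.ker f = ⊥ := by
    refine LinearMap.ker_eq_bot'.2 fun B (hB : S * of B * S⁻¹ = 0) => ?_
    calc of B = (S⁻¹ * S) * of B * (S⁻¹ * S) := by
          rw [nonsing_inv_mul S hS, Matrix.one_mul, Matrix.mul_one]
      _ = S⁻¹ * (S * of B * S⁻¹) * S := by simp only [Matrix.mul_assoc]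
      _ = 0 := by rw [hB, Matrix.mul_zero, Matrix.zero_mul]
  have hdet : LinearMap.det f ≠ 0 := fun h0 => (LinearMap.bot_lt_ker_of_det_eq_zero h0).ne' hker
  exact ⟨_, fun h hh => lintegral_comp_linearMap volume hdet hh⟩

/-- The constant `κ` depends on the eigenvector `(1, q)` only, so that eigenvector and eigenvalues
are independent. -/
lemma exists_lintegral_gaussDensity_eigenBlk (q : Fin n → ℂ) :
    ∃ κ : ℝ≥0∞, ∀ (x : ℂ) (G : (Fin n → Fin n → ℂ) → ℝ≥0∞), Measurable G →
      (∀ A B, (of A).charpoly = (of B).charpoly → G A = G B) →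
      ∫⁻ w : Fin n → ℂ, ∫⁻ B, G B * gaussDensity (eigenBlk x q w (B + fun i j => q i * w j)) =
        κ * (ENNReal.ofReal (Real.exp (-‖x‖ ^ 2)) * ∫⁻ B, G B * gaussDensity B) := by
  obtain ⟨M, S, b, hM, hS, hdensity⟩ := exists_gaussDensity_eigenBlk_eq q
  obtain ⟨k, hk⟩ := exists_lintegral_comp_conj hS
  set g : (Fin n → ℂ) → ℝ≥0∞ := fun v => ENNReal.ofReal (Real.exp (-∑ j, ‖v j‖ ^ 2))
  refine ⟨(‖M.det‖ₑ ^ 2)⁻¹ * (∫⁻ v, g v) * k, fun x G hGm hG => ?_⟩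
  have hconj B : G B = G (of.symm (S * of B * S⁻¹)) :=
    hG _ _ (charpoly_mul_mul_of_mul_eq_one (mul_nonsing_inv S hS) (of B)).symm
  have hconjm : Measurable fun B : Fin n → Fin n → ℂ => of.symm (S * of B * S⁻¹) := by
    refine measurable_pi_iff.2 fun i => measurable_pi_iff.2 fun j => ?_
    simp only [of_symm_apply, mul_apply, of_apply]
    fun_prop
  calc ∫⁻ w : Fin n → ℂ, ∫⁻ B, G B * gaussDensity (eigenBlk x q w (B + fun i j => q i * w j))
      = ∫⁻ B, ∫⁻ w : Fin n → ℂ,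
          G B * gaussDensity (eigenBlk x q w (B + fun i j => q i * w j)) :=
        lintegral_lintegral_swap (by fun_prop)
    _ = ∫⁻ B, ENNReal.ofReal (Real.exp (-‖x‖ ^ 2)) * ((‖M.det‖ₑ ^ 2)⁻¹ * ∫⁻ v, g v) *
          (G (of.symm (S * of B * S⁻¹)) * gaussDensity (of.symm (S * of B * S⁻¹))) := by
        refine lintegral_congr fun B => ?_
        simp_rw [hdensity, ← hconj]
        rw [← lintegral_comp_mulVec_add hM (b x B) (h := g) (by fun_prop),
          ← lintegral_const_mul _ (by fun_prop), ← lintegral_mul_const _ (by fun_prop)]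
        exact lintegral_congr fun w => by ring
    _ = ENNReal.ofReal (Real.exp (-‖x‖ ^ 2)) * ((‖M.det‖ₑ ^ 2)⁻¹ * ∫⁻ v, g v) *
          (k * ∫⁻ B, G B * gaussDensity B) := by
        rw [← hk (fun B => G B * gaussDensity B) (by fun_prop), lintegral_const_mul _ (by fun_prop)]
    _ = _ := by ring

lemma exists_measurable_lintegral_gaussDensity_eigenBlk (n : ℕ) :
    ∃ κ : (Fin n → ℂ) → ℝ≥0∞, Measurable κ ∧
      ∀ q (x : ℂ) (G : (Fin n → Fin n → ℂ) → ℝ≥0∞), Measurable G →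
      (∀ A B, (of A).charpoly = (of B).charpoly → G A = G B) →
      ∫⁻ w : Fin n → ℂ, ∫⁻ B, G B * gaussDensity (eigenBlk x q w (B + fun i j => q i * w j)) =
        κ q * (ENNReal.ofReal (Real.exp (-‖x‖ ^ 2)) * ∫⁻ B, G B * gaussDensity B) := by
  choose κ hκ using exists_lintegral_gaussDensity_eigenBlk (n := n)
  refine ⟨κ, ?_, hκ⟩
  have hκ_eq : κ = fun q =>
      (∫⁻ w : Fin n → ℂ, ∫⁻ B, gaussDensity (eigenBlk 0 q w (B + fun i j => q i * w j))) /
        ∫⁻ B, gaussDensity (n := n) B := by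
    ext q
    have h := hκ q 0 (fun _ => 1) measurable_const fun _ _ _ => rfl
    simp only [one_mul, norm_zero, ne_eq, OfNat.ofNat_ne_zero, not_false_eq_true, zero_pow,
      neg_zero, Real.exp_zero, ENNReal.ofReal_one] at h
    rw [h, ENNReal.mul_div_cancel_right lintegral_gaussDensity_ne_zero
      lintegral_gaussDensity_ne_top]
  rw [hκ_eq]
  fun_prop

end EigenvectorFibre

section EigenvalueLaw

open Matrix Polynomial
open scoped ENNReal

variable {n : ℕ}

lemma vandermondeWeight_cons (w : ℂ → ℝ) (x : ℂ) (u : Fin n → ℂ) :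
    vandermondeWeight w (Fin.cons x u : Fin (n + 1) → ℂ) =
      w x * ((∏ i, ‖x - u i‖ ^ 2) * vandermondeWeight w u) := by
  simp only [vandermondeWeight, Fin.prod_univ_succ, Fin.prod_Ioi_zero, Fin.prod_Ioi_succ,
    Fin.cons_zero, Fin.cons_succ, norm_sub_rev x]
  ring

/-- The functional `s ↦ Φ (x ∷ s) ∏ |x - y|²`, with `y` ranging over `s`, which a functional `Φ` of
all eigenvalues induces on the remaining ones once the eigenvalue `x` is split off. -/
noncomputable def splitEigenvalue (Φ : Multiset ℂ → ℝ≥0∞) (x : ℂ) (s : Multiset ℂ) : ℝ≥0∞ :=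
  (s.map fun y => ‖x - y‖ₑ ^ 2).prod * Φ (x ::ₘ s)

lemma enorm_eval_charpoly_sq (B : Matrix (Fin n) (Fin n) ℂ) (x : ℂ) :
    ‖B.charpoly.eval x‖ₑ ^ 2 = (B.charpoly.roots.map fun y => ‖x - y‖ₑ ^ 2).prod := by
  rw [(IsAlgClosed.splits B.charpoly).eval_eq_prod_roots_of_monic B.charpoly_monic]
  induction B.charpoly.roots using Multiset.induction with
  | empty => simp
  | cons y s ih => simp only [Multiset.map_cons, Multiset.prod_cons, enorm_mul, mul_pow, ih]

lemma roots_charpoly_eigenBlk (x : ℂ) (q w : Fin n → ℂ) (B : Fin n → Fin n → ℂ) :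
    (of (eigenBlk x q w (B + fun i j => q i * w j))).charpoly.roots =
      x ::ₘ (of B).charpoly.roots := by
  rw [charpoly_eigenBlk, roots_mul (mul_ne_zero (X_sub_C_ne_zero x) (charpoly_monic _).ne_zero),
    roots_X_sub_C, Multiset.singleton_add]

lemma roots_charpoly_diagonal (u : Fin n → ℂ) :
    (diagonal u).charpoly.roots = Finset.univ.val.map u := by
  rw [charpoly_diagonal, Finset.prod_eq_multiset_prod,
    ← roots_multiset_prod_X_sub_C (Finset.univ.val.map u), Multiset.map_map, Function.comp_def]

@[fun_prop]
lemma measurable_diagonal :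
    Measurable fun u : Fin n → ℂ => (of.symm (diagonal u) : Fin n → Fin n → ℂ) :=
  measurable_pi_iff.2 fun i => measurable_pi_iff.2 fun j =>
    (continuous_id.matrix_diagonal.matrix_elem i j).measurable

lemma measurable_comp_map_univ {α : Type*} [MeasurableSpace α] {Φ : α → Multiset ℂ → ℝ≥0∞}
    (hΦ : Measurable fun p : α × (Fin n → Fin n → ℂ) => Φ p.1 (of p.2).charpoly.roots) :
    Measurable fun p : α × (Fin n → ℂ) => Φ p.1 (Finset.univ.val.map p.2) := by
  have h := hΦ.comp (measurable_fst.prodMk (measurable_diagonal.comp measurable_snd))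
  simpa only [Function.comp_def, Equiv.apply_symm_apply, roots_charpoly_diagonal] using h

lemma measurable_splitEigenvalue {Φ : Multiset ℂ → ℝ≥0∞}
    (hΦ : Measurable fun A : Fin (n + 1) → Fin (n + 1) → ℂ => Φ (of A).charpoly.roots) :
    Measurable fun p : ℂ × (Fin n → Fin n → ℂ) =>
      splitEigenvalue Φ p.1 (of p.2).charpoly.roots := by
  have h := hΦ.comp (f := fun p : ℂ × (Fin n → Fin n → ℂ) =>
    eigenBlk p.1 0 0 (p.2 + fun i j => (0 : Fin n → ℂ) i * (0 : Fin n → ℂ) j)) (by fun_prop)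
  simp only [splitEigenvalue, ← enorm_eval_charpoly_sq]
  simp only [Function.comp_def, roots_charpoly_eigenBlk] at h
  exact (by fun_prop : Measurable fun p : ℂ × (Fin n → Fin n → ℂ) =>
    ‖(of p.2).charpoly.eval p.1‖ₑ ^ 2).mul h

lemma measurable_splitEigenvalue_right {Φ : Multiset ℂ → ℝ≥0∞}
    (hΦ : Measurable fun A : Fin (n + 1) → Fin (n + 1) → ℂ => Φ (of A).charpoly.roots) (x : ℂ) :
    Measurable fun B : Fin n → Fin n → ℂ => splitEigenvalue Φ x (of B).charpoly.roots := by
  simpa only [Function.comp_def] using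
    (measurable_splitEigenvalue hΦ).comp (measurable_prodMk_left (x := x))

lemma univ_val_map_cons (x : ℂ) (u : Fin n → ℂ) :
    Finset.univ.val.map (Fin.cons x u : Fin (n + 1) → ℂ) = x ::ₘ Finset.univ.val.map u := by
  simp only [Fin.univ_val_map, List.ofFn_succ, Fin.cons_zero, Fin.cons_succ, Multiset.cons_coe]

@[fun_prop]
lemma measurable_vandermondeWeight {w : ℂ → ℝ} (hw : Measurable w) :
    Measurable (vandermondeWeight (n := n) w) := by
  unfold vandermondeWeight
  fun_prop

lemma measurable_exp_neg_norm_sq : Measurable fun z : ℂ => Real.exp (-‖z‖ ^ 2) := by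
  fun_prop

lemma measurable_lintegral_splitEigenvalue {Φ : Multiset ℂ → ℝ≥0∞}
    (hΦ : Measurable fun A : Fin (n + 1) → Fin (n + 1) → ℂ => Φ (of A).charpoly.roots)
    {w : ℂ → ℝ} (hw : Measurable w) :
    Measurable fun x => ENNReal.ofReal (w x) * ∫⁻ u : Fin n → ℂ,
      splitEigenvalue Φ x (Finset.univ.val.map u) * ENNReal.ofReal (vandermondeWeight w u) := by
  have hprod : Measurable fun p : ℂ × (Fin n → ℂ) =>
      splitEigenvalue Φ p.1 (Finset.univ.val.map p.2) *
        ENNReal.ofReal (vandermondeWeight w p.2) :=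
    (measurable_comp_map_univ (measurable_splitEigenvalue hΦ)).mul (by fun_prop)
  exact hw.ennreal_ofReal.mul hprod.lintegral_prod_right'

lemma lintegral_mul_vandermondeWeight {Φ : Multiset ℂ → ℝ≥0∞}
    (hΦ : Measurable fun A : Fin (n + 1) → Fin (n + 1) → ℂ => Φ (of A).charpoly.roots)
    {w : ℂ → ℝ} (hw : Measurable w) (hw0 : ∀ z, 0 ≤ w z) :
    ∫⁻ v : Fin (n + 1) → ℂ, Φ (Finset.univ.val.map v) * ENNReal.ofReal (vandermondeWeight w v) =
      ∫⁻ x, ENNReal.ofReal (w x) * ∫⁻ u : Fin n → ℂ,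
        splitEigenvalue Φ x (Finset.univ.val.map u) * ENNReal.ofReal (vandermondeWeight w u) := by
  have hΦ' : Measurable fun v : Fin (n + 1) → ℂ => Φ (Finset.univ.val.map v) :=
    (measurable_comp_map_univ (α := Unit) (Φ := fun _ => Φ) (hΦ.comp measurable_snd)).comp
      (measurable_prodMk_left (x := ()))
  have hv : Measurable fun v : Fin (n + 1) → ℂ =>
      Φ (Finset.univ.val.map v) * ENNReal.ofReal (vandermondeWeight w v) :=
    hΦ'.mul (by fun_prop)
  have hcons := measurePreserving_cons (n := n) ℂ
  have hvcons : Measurable fun p : ℂ × (Fin n → ℂ) =>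
      Φ (Finset.univ.val.map (Fin.cons p.1 p.2 : Fin (n + 1) → ℂ)) *
        ENNReal.ofReal (vandermondeWeight w (Fin.cons p.1 p.2 : Fin (n + 1) → ℂ)) :=
    hv.comp hcons.measurable
  rw [← hcons.lintegral_comp hv, Measure.volume_eq_prod, lintegral_prod _ hvcons.aemeasurable]
  refine lintegral_congr fun x => ?_
  rw [← lintegral_const_mul' _ _ ENNReal.ofReal_ne_top]
  refine lintegral_congr fun u => ?_
  rw [univ_val_map_cons, vandermondeWeight_cons, ENNReal.ofReal_mul (hw0 x),
    ENNReal.ofReal_mul (by positivity), ENNReal.ofReal_prod_of_nonneg fun _ _ => by positivity,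
    splitEigenvalue, Multiset.map_map, Function.comp_def, ← Finset.prod_eq_multiset_prod]
  simp only [ENNReal.ofReal_pow (norm_nonneg _), ofReal_norm]
  ring

lemma exists_lintegral_splitEigenvalue (n : ℕ) :
    ∃ K : ℝ≥0∞, ∀ Φ : Multiset ℂ → ℝ≥0∞,
      Measurable (fun A : Fin (n + 1) → Fin (n + 1) → ℂ => Φ (of A).charpoly.roots) →
      ((n + 1 : ℕ) : ℝ≥0∞) *
          ∫⁻ A : Fin (n + 1) → Fin (n + 1) → ℂ, Φ (of A).charpoly.roots * gaussDensity A =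
        K * ∫⁻ x, ENNReal.ofReal (Real.exp (-‖x‖ ^ 2)) *
          ∫⁻ B : Fin n → Fin n → ℂ, splitEigenvalue Φ x (of B).charpoly.roots * gaussDensity B := by
  obtain ⟨κ, hκm, hκ⟩ := exists_measurable_lintegral_gaussDensity_eigenBlk n
  refine ⟨∫⁻ q, κ q, fun Φ hΦ => ?_⟩
  have hsplit := measurable_splitEigenvalue hΦ
  have hjoint : Measurable fun p : ℂ × (Fin n → Fin n → ℂ) =>
      splitEigenvalue Φ p.1 (of p.2).charpoly.roots * gaussDensity p.2 :=
    hsplit.mul (measurable_gaussDensity.comp measurable_snd)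
  have houter : Measurable fun x => ENNReal.ofReal (Real.exp (-‖x‖ ^ 2)) *
      ∫⁻ B : Fin n → Fin n → ℂ, splitEigenvalue Φ x (of B).charpoly.roots * gaussDensity B :=
    measurable_exp_neg_norm_sq.ennreal_ofReal.mul hjoint.lintegral_prod_right'
  rw [lintegral_eigenBlk (F := fun A => Φ (of A).charpoly.roots * gaussDensity A)
    (hΦ.mul measurable_gaussDensity), ← lintegral_const_mul _ houter]
  refine lintegral_congr fun x => ?_
  rw [← lintegral_mul_const _ hκm]
  refine lintegral_congr fun q => ?_
  rw [← hκ q x (fun B => splitEigenvalue Φ x (of B).charpoly.roots)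
    (measurable_splitEigenvalue_right hΦ x) fun A B h => by simp only [h]]
  simp only [roots_charpoly_eigenBlk, ← mul_assoc, enorm_eval_charpoly_sq, splitEigenvalue]

theorem exists_lintegral_roots_charpoly (n : ℕ) :
    ∃ C : ℝ≥0∞, ∀ Φ : Multiset ℂ → ℝ≥0∞,
      Measurable (fun A : Fin n → Fin n → ℂ => Φ (of A).charpoly.roots) →
      ∫⁻ A : Fin n → Fin n → ℂ, Φ (of A).charpoly.roots * gaussDensity A =
        C * ∫⁻ u : Fin n → ℂ, Φ (Finset.univ.val.map u) *
          ENNReal.ofReal (vandermondeWeight (fun z => Real.exp (-‖z‖ ^ 2)) u) := by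
  induction n with
  | zero =>
    refine ⟨1, fun Φ _ => ?_⟩
    simp [volume_pi, gaussDensity, frobSq, vandermondeWeight]
  | succ n ih =>
    obtain ⟨C, hC⟩ := ih
    obtain ⟨K, hK⟩ := exists_lintegral_splitEigenvalue n
    refine ⟨((n + 1 : ℕ) : ℝ≥0∞)⁻¹ * (K * C), fun Φ hΦ => ?_⟩
    have hpeel : ((n + 1 : ℕ) : ℝ≥0∞) *
        ∫⁻ A : Fin (n + 1) → Fin (n + 1) → ℂ, Φ (of A).charpoly.roots * gaussDensity A =
        K * (C * ∫⁻ v : Fin (n + 1) → ℂ, Φ (Finset.univ.val.map v) *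
          ENNReal.ofReal (vandermondeWeight (fun z => Real.exp (-‖z‖ ^ 2)) v)) := by
      rw [hK Φ hΦ, lintegral_mul_vandermondeWeight hΦ measurable_exp_neg_norm_sq
          fun z => (Real.exp_pos _).le,
        ← lintegral_const_mul C
          (measurable_lintegral_splitEigenvalue hΦ measurable_exp_neg_norm_sq)]
      refine congrArg (K * ·) (lintegral_congr fun x => ?_)
      rw [hC (splitEigenvalue Φ x) (measurable_splitEigenvalue_right hΦ x), mul_left_comm]
    rw [mul_assoc, mul_assoc, ← hpeel, ← mul_assoc, ENNReal.inv_mul_cancel (by simp) (by simp),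
      one_mul]

lemma norm_eval_charpoly_rpow (B : Matrix (Fin n) (Fin n) ℂ) (a : ℂ) (γ : ℝ) :
    ‖B.charpoly.eval a‖ ^ γ = (B.charpoly.roots.map fun y => ‖y - a‖ ^ γ).prod := by
  rw [(IsAlgClosed.splits B.charpoly).eval_eq_prod_roots_of_monic B.charpoly_monic]
  induction B.charpoly.roots using Multiset.induction with
  | empty => simp
  | cons y s ih =>
    simp only [Multiset.map_cons, Multiset.prod_cons, norm_mul, norm_sub_rev a y,
      Real.mul_rpow (norm_nonneg _) (norm_nonneg _), ih]

lemma exists_lintegral_norm_eval_charpoly_rpow (n : ℕ) :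
    ∃ C : ℝ≥0∞, ∀ (γ : ℝ) (a : ℂ),
      ∫⁻ A : Fin n → Fin n → ℂ, ENNReal.ofReal (‖(of A).charpoly.eval a‖ ^ γ) * gaussDensity A =
        C * ∫⁻ u : Fin n → ℂ, ENNReal.ofReal (vandermondeWeight (chargeWeight γ 1 a 0) u) := by
  obtain ⟨C, hC⟩ := exists_lintegral_roots_charpoly n
  refine ⟨C, fun γ a => ?_⟩
  have h := hC (fun s => ENNReal.ofReal (s.map fun y => ‖y - a‖ ^ γ).prod) (by
    simp only [← norm_eval_charpoly_rpow]
    fun_prop)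
  simp only [← norm_eval_charpoly_rpow] at h
  rw [h]
  congr 1
  refine lintegral_congr fun u => ?_
  rw [Multiset.map_map, Function.comp_def, ← Finset.prod_eq_multiset_prod,
    ← ENNReal.ofReal_mul (by positivity), vandermondeWeight, vandermondeWeight, ← mul_assoc,
    ← Finset.prod_mul_distrib]
  simp only [chargeWeight, sub_zero, neg_mul, one_mul]

end EigenvalueLaw

section GaussianMeasure

open scoped ENNReal

lemma lintegral_pi_prod_ofReal {ι E : Type*} [Fintype ι] [MeasurableSpace E] (μ : ι → Measure E)
    [∀ i, SigmaFinite (μ i)] {f : E → ℝ} (hf : ∀ i, Integrable f (μ i)) (h0 : ∀ x, 0 ≤ f x) :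
    ∫⁻ x : ι → E, ENNReal.ofReal (∏ i, f (x i)) ∂Measure.pi μ =
      ∏ i, ∫⁻ x, ENNReal.ofReal (f x) ∂μ i := by
  rw [← ofReal_integral_eq_lintegral_ofReal (Integrable.fintype_prod_dep (f := fun _ => f) hf)
    (ae_of_all _ fun x => Finset.prod_nonneg fun i _ => h0 _),
    integral_fintype_prod_eq_prod (fun _ => f), ENNReal.ofReal_prod_of_nonneg fun i _ =>
      integral_nonneg h0]
  exact Finset.prod_congr rfl fun i _ =>
    ofReal_integral_eq_lintegral_ofReal (hf i) (ae_of_all _ h0)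

lemma pi_withDensity_ofReal {ι E : Type*} [Fintype ι] [MeasurableSpace E] (μ : Measure E)
    [SigmaFinite μ] {f : E → ℝ} (hf : Integrable f μ) (h0 : ∀ x, 0 ≤ f x) :
    Measure.pi (fun _ : ι => μ.withDensity fun x => ENNReal.ofReal (f x)) =
      (Measure.pi fun _ : ι => μ).withDensity fun x => ENNReal.ofReal (∏ i, f (x i)) := by
  have : IsFiniteMeasure (μ.withDensity fun x => ENNReal.ofReal (f x)) :=
    isFiniteMeasure_withDensity_ofReal hf.2
  refine Measure.pi_eq fun s hs => ?_
  rw [withDensity_apply _ (MeasurableSet.univ_pi hs), Measure.restrict_pi_pi,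
    lintegral_pi_prod_ofReal _ (fun i => hf.restrict) h0]
  exact Finset.prod_congr rfl fun i _ => (withDensity_apply _ (hs i)).symm

lemma measurePreserving_uncurry {ι κ E : Type*} [Fintype ι] [Fintype κ] [MeasureSpace E]
    [SigmaFinite (volume : Measure E)] :
    MeasurePreserving fun (A : ι → κ → E) (p : ι × κ) => A p.1 p.2 := by
  have hm : Measurable fun (A : ι → κ → E) (p : ι × κ) => A p.1 p.2 := by fun_prop
  refine ⟨hm, ?_⟩
  rw [volume_pi (ι := ι × κ)]
  refine (Measure.pi_eq fun s hs => ?_).symm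
  have hpre : (fun (A : ι → κ → E) (p : ι × κ) => A p.1 p.2) ⁻¹' Set.univ.pi s =
      Set.univ.pi fun i => Set.univ.pi fun j => s (i, j) := by
    ext A
    simp [Set.mem_pi, Prod.forall]
  rw [Measure.map_apply hm (MeasurableSet.univ_pi hs), hpre, volume_pi_pi, Fintype.prod_prod_type]
  exact Finset.prod_congr rfl fun i _ => volume_pi_pi _

lemma lintegral_stdComplexNormal :
    ∫⁻ z : ℂ, ENNReal.ofReal (Real.pi⁻¹ * Real.exp (-‖z‖ ^ 2)) = 1 := by
  rw [← ofReal_integral_eq_lintegral_ofReal (integrable_exp_neg_norm_sq.const_mul _)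
    (ae_of_all _ fun z => by positivity), integral_const_mul]
  have h := Complex.integral_exp_neg_rpow (p := 2) (by norm_num)
  simp only [Real.rpow_two] at h
  rw [h]
  norm_num [Real.pi_ne_zero]

instance isProbabilityMeasure_stdComplexNormal : IsProbabilityMeasure stdComplexNormal :=
  ⟨by rw [stdComplexNormal, withDensity_apply _ MeasurableSet.univ, Measure.restrict_univ,
    lintegral_stdComplexNormal]⟩

instance isProbabilityMeasure_gaussianEntries (N : ℕ) :
    IsProbabilityMeasure (gaussianEntries N) := by
  unfold gaussianEntries
  infer_instance

lemma lintegral_gaussianEntries {N : ℕ} (Φ : (Fin N × Fin N → ℂ) → ℝ≥0∞) (hΦ : Measurable Φ) :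
    ∫⁻ g, Φ g ∂gaussianEntries N = ENNReal.ofReal (Real.pi⁻¹ ^ (N * N)) *
      ∫⁻ A : Fin N → Fin N → ℂ, Φ (fun p => A p.1 p.2) * gaussDensity A := by
  have hdens : Measurable fun g : Fin N × Fin N → ℂ =>
      ENNReal.ofReal (∏ p, Real.pi⁻¹ * Real.exp (-‖g p‖ ^ 2)) := by fun_prop
  rw [gaussianEntries, stdComplexNormal,
    pi_withDensity_ofReal volume (integrable_exp_neg_norm_sq.const_mul _) fun z => by positivity,
    lintegral_withDensity_eq_lintegral_mul _ hdens hΦ, ← volume_pi,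
    ← measurePreserving_uncurry.lintegral_comp (hdens.mul hΦ),
    ← lintegral_const_mul' _ _ ENNReal.ofReal_ne_top]
  refine lintegral_congr fun A => ?_
  rw [Pi.mul_apply, Finset.prod_mul_distrib, Finset.prod_const, Finset.card_univ, Fintype.card_prod,
    Fintype.card_fin, ENNReal.ofReal_mul (by positivity), Fintype.prod_prod_type, gaussDensity,
    exp_neg_frobSq]
  simp only [Matrix.of_apply]
  ring

end GaussianMeasure

section CharacteristicPolynomialMoments

open scoped ENNReal

variable {N : ℕ} {γ : ℝ}

lemma absDetPow_nonneg (N : ℕ) (γ : ℝ) (x : ℂ) (g : Fin N × Fin N → ℂ) : 0 ≤ absDetPow N γ x g :=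
  Real.rpow_nonneg (norm_nonneg _) _

lemma measurable_absDetPow (N : ℕ) (γ : ℝ) (x : ℂ) : Measurable (absDetPow N γ x) := by
  have hentries : Continuous fun g : Fin N × Fin N → ℂ => ginibreMatrix N g :=
    continuous_matrix fun i j => by
      simp only [ginibreMatrix, Matrix.of_apply]
      fun_prop
  exact (hentries.sub continuous_const).matrix_det.measurable.norm.pow_const γ

lemma absDetPow_eq_norm_eval_charpoly_rpow (hN : 0 < N) (γ : ℝ) (x : ℂ) (A : Fin N → Fin N → ℂ) :
    absDetPow N γ x (fun p => A p.1 p.2) =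
      Real.sqrt N ^ (-(N * γ)) * ‖(Matrix.of A).charpoly.eval (Real.sqrt N * x)‖ ^ γ := by
  have hsqrt : 0 < Real.sqrt N := Real.sqrt_pos.2 (Nat.cast_pos.2 hN)
  have hsqrt' : (Real.sqrt N : ℂ) ≠ 0 := by exact_mod_cast hsqrt.ne'
  have hscale : ginibreMatrix N (fun p => A p.1 p.2) - x • (1 : Matrix (Fin N) (Fin N) ℂ) =
      (-(Real.sqrt N : ℂ)⁻¹) • (Matrix.scalar (Fin N) (Real.sqrt N * x) - Matrix.of A) := by
    rw [Matrix.scalar_apply, ← Matrix.smul_one_eq_diagonal]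
    ext i j
    simp only [ginibreMatrix, Matrix.sub_apply, Matrix.of_apply, Matrix.smul_apply, smul_eq_mul]
    field_simp
    ring
  rw [absDetPow, hscale, Matrix.det_smul, Fintype.card_fin, ← Matrix.eval_charpoly, norm_mul,
    Real.mul_rpow (norm_nonneg _) (norm_nonneg _), norm_pow, norm_neg, norm_inv, Complex.norm_real,
    Real.norm_of_nonneg hsqrt.le, inv_pow, Real.inv_rpow (by positivity), ← Real.rpow_natCast,
    ← Real.rpow_mul hsqrt.le, ← Real.rpow_neg hsqrt.le]

theorem exists_lintegral_absDetPow (hN : 0 < N) (x : ℂ) : ∃ c : ℝ≥0∞, ∀ γ : ℝ, -2 < γ →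
    ∫⁻ g, ENNReal.ofReal (absDetPow N γ x g) ∂gaussianEntries N =
      c * ENNReal.ofReal (∫ z : Fin N → ℂ, vandermondeWeight (chargeWeight γ N x 0) z) := by
  obtain ⟨C, hC⟩ := exists_lintegral_norm_eval_charpoly_rpow N
  have hsqrt : 0 < Real.sqrt N := Real.sqrt_pos.2 (Nat.cast_pos.2 hN)
  refine ⟨ENNReal.ofReal (Real.pi⁻¹ ^ (N * N)) * C *
    ENNReal.ofReal (Real.sqrt N ^ ((N : ℝ) * (N + 1))), fun γ hγ => ?_⟩
  have hcharge : ∫⁻ u : Fin N → ℂ,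
        ENNReal.ofReal (vandermondeWeight (chargeWeight γ 1 (Real.sqrt N * x) 0) u) =
      ENNReal.ofReal (Real.sqrt N ^ ((N : ℝ) * (N + 1) + N * γ) *
        ∫ z : Fin N → ℂ, vandermondeWeight (chargeWeight γ N x 0) z) := by
    rw [← ofReal_integral_eq_lintegral_ofReal
      (hasFiniteMoments_chargeWeight hγ one_pos).integrable_vandermondeWeight
      (ae_of_all _ (vandermondeWeight_nonneg chargeWeight_nonneg)),
      integral_vandermondeWeight_chargeWeight_comp_affine 0 hsqrt.ne', abs_of_pos hsqrt, one_mul,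
      Real.sq_sqrt N.cast_nonneg, sub_zero, sub_zero, smul_zero, ← Complex.real_smul,
      inv_smul_smul₀ hsqrt.ne']
  rw [lintegral_gaussianEntries _ (measurable_absDetPow N γ x).ennreal_ofReal]
  simp_rw [absDetPow_eq_norm_eval_charpoly_rpow hN,
    ENNReal.ofReal_mul (Real.rpow_nonneg hsqrt.le _), mul_assoc]
  rw [lintegral_const_mul' _ _ ENNReal.ofReal_ne_top, hC, hcharge, mul_left_comm _ (C : ℝ≥0∞),
    ← ENNReal.ofReal_mul (by positivity), ← mul_assoc (Real.sqrt N ^ _), ← Real.rpow_add hsqrt,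
    neg_add_cancel_comm_assoc, ENNReal.ofReal_mul (by positivity)]

/-- The unknown normalisation of the eigenvalue law is read off at `γ = 0`. -/
theorem lintegral_absDetPow (hN : 0 < N) (hγ : -2 < γ) (x : ℂ) :
    ∫⁻ g, ENNReal.ofReal (absDetPow N γ x g) ∂gaussianEntries N =
      ENNReal.ofReal ((∫ z : Fin N → ℂ, vandermondeWeight (chargeWeight γ N x 0) z) /
        partitionFunction N ginibrePotential) := by
  obtain ⟨c, hc⟩ := exists_lintegral_absDetPow hN x
  have hnormalised := hc 0 (by norm_num)
  simp only [absDetPow, Real.rpow_zero, ENNReal.ofReal_one, lintegral_const, measure_univ, mul_one,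
    ← weight_ginibrePotential] at hnormalised
  rw [← partitionFunction] at hnormalised
  rw [hc γ hγ, ENNReal.eq_inv_of_mul_eq_one_left hnormalised.symm, mul_comm, ← div_eq_mul_inv,
    ENNReal.ofReal_div_of_pos (partitionFunction_ginibrePotential_pos hN)]

theorem integrable_absDetPow (hN : 0 < N) (hγ : -2 < γ) (x : ℂ) :
    Integrable (absDetPow N γ x) (gaussianEntries N) := by
  rw [← lintegral_ofReal_ne_top_iff_integrable (measurable_absDetPow N γ x).aestronglyMeasurable
    (ae_of_all _ (absDetPow_nonneg N γ x)), lintegral_absDetPow hN hγ]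
  exact ENNReal.ofReal_ne_top

theorem partitionFunction_ginibrePotential_mul_ginibreMoment (hN : 0 < N) (hγ : -2 < γ) (x : ℂ) :
    partitionFunction N ginibrePotential * ginibreMoment N γ x =
      ∫ z : Fin N → ℂ, vandermondeWeight (chargeWeight γ N x 0) z := by
  have hZ := partitionFunction_ginibrePotential_pos hN
  have hI : 0 ≤ ∫ z : Fin N → ℂ, vandermondeWeight (chargeWeight γ N x 0) z :=
    integral_nonneg (vandermondeWeight_nonneg chargeWeight_nonneg)
  rw [ginibreMoment, integral_eq_lintegral_of_nonneg_ae (ae_of_all _ (absDetPow_nonneg N γ x))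
    (measurable_absDetPow N γ x).aestronglyMeasurable, lintegral_absDetPow hN hγ,
    ENNReal.toReal_ofReal (by positivity), mul_div_cancel₀ _ hZ.ne']

theorem partitionFunction_lemniscatePotential_eq_mul_prod_ginibreMoment {d : ℕ} (hN : 0 < N)
    (hd : 0 < d) (t : ℝ) :
    partitionFunction (N * d) (lemniscatePotential d t) =
      Real.exp (((N : ℝ) * t * d) ^ 2) * reductionConstant N d *
        partitionFunction N ginibrePotential ^ d *
        ∏ ℓ ∈ Finset.range d,
          ginibreMoment N (gammaExponent d ℓ) ((t * Real.sqrt d : ℝ) : ℂ) := by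
  simp_rw [partitionFunction_lemniscatePotential hN hd,
    ← partitionFunction_ginibrePotential_mul_ginibreMoment hN (neg_two_lt_gammaExponent hd _),
    Finset.prod_mul_distrib, Finset.prod_const, Finset.card_range, mul_assoc]

end CharacteristicPolynomialMoments

end Lemniscate

theorem mainTheorem10 (N d : ℕ) (hN : 1 ≤ N) (hd : 1 ≤ d) (t : ℝ) :
    -- all integrals and expectations involved converge
    Integrable (Lemniscate.weight (N * d) (Lemniscate.lemniscatePotential d t)) ∧
    Integrable (Lemniscate.weight N Lemniscate.ginibrePotential) ∧
    (∀ ℓ ∈ Finset.range d,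
      Integrable
        (Lemniscate.absDetPow N (Lemniscate.gammaExponent d ℓ) ((t * Real.sqrt d : ℝ) : ℂ))
        (Lemniscate.gaussianEntries N)) ∧
    -- the factorisation
    Lemniscate.partitionFunction (N * d) (Lemniscate.lemniscatePotential d t) =
      Real.exp (((N : ℝ) * t * d) ^ 2) * Lemniscate.reductionConstant N d *
        Lemniscate.partitionFunction N Lemniscate.ginibrePotential ^ d *
        ∏ ℓ ∈ Finset.range d,
          Lemniscate.ginibreMoment N (Lemniscate.gammaExponent d ℓ)
            ((t * Real.sqrt d : ℝ) : ℂ) ∧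
    -- the explicit value of the Ginibre partition function
    Lemniscate.partitionFunction N Lemniscate.ginibrePotential =
      Real.pi ^ N * (∏ k ∈ Finset.Icc 1 N, (k.factorial : ℝ)) /
        (N : ℝ) ^ ((N : ℝ) * (N + 1) / 2) :=
  ⟨Lemniscate.integrable_weight_lemniscatePotential hN hd t,
    Lemniscate.integrable_weight_ginibrePotential hN,
    fun ℓ _ => Lemniscate.integrable_absDetPow hN (Lemniscate.neg_two_lt_gammaExponent hd ℓ) _,
    Lemniscate.partitionFunction_lemniscatePotential_eq_mul_prod_ginibreMoment hN hd t,
    Lemniscate.partitionFunction_ginibrePotential hN⟩
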